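/- Let $(X,\Sigma,\mathfrak m)$ be a complete, $\sigma$-finite measure space and let $\mathbb B$ be a universal separable Banach space, i.e. a real separable Banach space into which every real separable Banach space embeds linearly and isometrically. **Bundles.** A separable Banach $\mathbb B$-bundle over $X$ is a map $\mathbf E$ from $X$ to the closed linear subspaces of $\mathbb B$ such that $\{x : \mathbf E(x)\cap U\neq\emptyset\}\in\Sigma$ for every open $U\subseteq\mathbb B$. Let $\mathrm T\mathbf E=\{(x,v)\in X\times\mathbb B : v\in\mathbf E(x)\}$, with the $\sigma$-algebra induced by $\Sigma\otimes\mathscr B(\mathbb B)$. A pre-morphism $\bar\varphi:\mathbf E\to\mathbf F$ is a measurable map $\mathrm T\mathbf E\to\mathrm T\mathbf F$ which, for every $x\in X$, maps $\{x\}\times\mathbf E(x)$ into $\{x\}\times\mathbf F(x)$ and restricts there to a linear contraction $\bar\varphi(x,\cdot):\mathbf E(x)\to\mathbf F(x)$ (norm at most $1$). Two pre-morphisms are equivalent if they agree on all fibers over the complement of an $\mathfrak m$-null set of $\Sigma$; a morphism is an equivalence class. This gives the category $\mathbf{SBB}_{\mathbb B}(X,\Sigma,\mathfrak m)$. **Modules.**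 Let $L^0(\mathfrak m)$ be the ring of $\mathfrak m$-a.e. equality classes of measurable functions $X\to\mathbb R$, with the distance $d_{L^0}(f,g)=\int \min(|f-g|,1)\,d\mathfrak m'$, where $\mathfrak m'$ is a finite measure with the same null sets as $\mathfrak m$ (the induced topology and completeness do not depend on $\mathfrak m'$). A normed $L^0(\mathfrak m)$-module is an $L^0(\mathfrak m)$-module $\mathscr M$ with a map $|\cdot|:\mathscr M\to L^0(\mathfrak m)$ such that, $\mathfrak m$-a.e., $|v|\ge 0$ with equality iff $v=0$, $|v+w|\le|v|+|w|$ and $|f\cdot v|=|f||v|$, and such that the distance $d_{\mathscr M}(v,w)=d_{L^0}(|v-w|,0)$ is complete. A morphism is an $L^0(\mathfrak m)$-linear map $\Phi$ with $|\Phi(v)|\le|v|$ $\mathfrak m$-a.e. for all $v$. $\mathscr M$ is countably-generated if the $L^0(\mathfrak m)$-submodule generated by some countable subset is dense in $\mathscr M$, and separable if $(\mathscr M,d_{\mathscr M})$ is separable. Let $\mathbf{NMod}_{\rm cg}(X,\Sigma,\mathfrak m)$ and $\mathbf{NMod}_{\rm s}(X,\Sigma,\mathfrak m)$ be the full subcategories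 of countably-generated, respectively separable, normed $L^0(\mathfrak m)$-modules. **The section functor.** For a bundle $\mathbf E$, $\Gamma(\mathbf E)$ is the space of measurable maps $\bar s:X\to\mathbb B$ with $\bar s(x)\in\mathbf E(x)$ for every $x$, modulo $\mathfrak m$-a.e. equality, with the pointwise operations and the pointwise norm $|s|(x)=\|\bar s(x)\|_{\mathbb B}$. For a morphism $\varphi$, $\Gamma(\varphi)$ sends the class of $\bar s$ to the class of $x\mapsto\bar\varphi(x,\bar s(x))$. **Theorem (Serre–Swan).** Every $\Gamma(\mathbf E)$ is countably-generated, and the section functor $$\Gamma:\mathbf{SBB}_{\mathbb B}(X,\Sigma,\mathfrak m)\longrightarrow\mathbf{NMod}_{\rm cg}(X,\Sigma,\mathfrak m)$$ is an equivalence of categories. If moreover $(X,\Sigma,\mathfrak m)$ is a separable measure space, i.e. for some finite measure $\mathfrak m'$ with the same null sets as $\mathfrak m$ the (pseudo)metric $(A,B)\mapsto\mathfrak m'(A\Delta B)$ on $\Sigma$ is separable, then every $\Gamma(\mathbf E)$ is separable and $$\Gamma:\mathbf{SBB}_{\mathbb B}(X,\Sigma,\mathfrak m)\longrightarrow\mathbf{NMod}_{\rm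 s}(X,\Sigma,\mathfrak m)$$ is an equivalence of categories. -/

import Mathlib

open MeasureTheory CategoryTheory TopologicalSpace Filter Topology

universe u v w

namespace SerreSwan

section L0

variable {X : Type u} [MeasurableSpace X]

/-- The space `L⁰(μ)` of classes of measurable real functions up to a.e. equality. It carries the
a.e. order, and `|f|` is the pointwise absolute value. -/
abbrev L0 (μ : Measure X) : Type u := X →ₘ[μ] ℝ

/-- The pointwise ring structure on `L⁰(μ)`. -/
noncomputable instance L0.instCommRing (μ : Measure X) : CommRing (L0 μ) where
  __ := (inferInstance : AddCommGroup (L0 μ))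
  __ := (inferInstance : CommMonoid (L0 μ))
  left_distrib f g h := by
    apply AEEqFun.ext
    filter_upwards [AEEqFun.coeFn_mul f (g + h), AEEqFun.coeFn_add g h,
      AEEqFun.coeFn_add (f * g) (f * h), AEEqFun.coeFn_mul f g, AEEqFun.coeFn_mul f h]
      with x h1 h2 h3 h4 h5
    simp only [Pi.mul_apply, Pi.add_apply] at *
    rw [h1, h2, h3, h4, h5, mul_add]
  right_distrib f g h := by
    apply AEEqFun.ext
    filter_upwards [AEEqFun.coeFn_mul (f + g) h, AEEqFun.coeFn_add f g,
      AEEqFun.coeFn_add (f * h) (g * h), AEEqFun.coeFn_mul f h, AEEqFun.coeFn_mul g h]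
      with x h1 h2 h3 h4 h5
    simp only [Pi.mul_apply, Pi.add_apply] at *
    rw [h1, h2, h3, h4, h5, add_mul]
  zero_mul f := by
    apply AEEqFun.ext
    filter_upwards [AEEqFun.coeFn_mul (0 : L0 μ) f, AEEqFun.coeFn_zero (α := X) (μ := μ) (β := ℝ)]
      with x h1 h2
    simp only [Pi.mul_apply, Pi.zero_apply] at *
    rw [h1, h2, zero_mul]
  mul_zero f := by
    apply AEEqFun.ext
    filter_upwards [AEEqFun.coeFn_mul f (0 : L0 μ), AEEqFun.coeFn_zero (α := X) (μ := μ) (β := ℝ)]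
      with x h1 h2
    simp only [Pi.mul_apply, Pi.zero_apply] at *
    rw [h1, h2, mul_zero]

/-- The distance `∫ min |f - g| 1 dμ'` on `L⁰(μ)`, where `μ' = μ.toFinite` is a finite measure with
the same null sets as `μ` (a probability measure if `μ ≠ 0`). -/
noncomputable def L0.dist (μ : Measure X) [SigmaFinite μ] (f g : L0 μ) : ℝ :=
  ∫ x, min |f x - g x| 1 ∂μ.toFinite

/-- A pointwise norm on an algebraic `L⁰(μ)`-module. -/
class PointwiseNorm (μ : Measure X) (M : Type w) [AddCommGroup M] [Module (L0 μ) M] where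
  pnorm : M → L0 μ
  pnorm_nonneg : ∀ v, 0 ≤ pnorm v
  pnorm_eq_zero_iff : ∀ v, pnorm v = 0 ↔ v = 0
  pnorm_add_le : ∀ v w, pnorm (v + w) ≤ pnorm v + pnorm w
  pnorm_smul : ∀ (f : L0 μ) (v : M), pnorm (f • v) = |f| * pnorm v

variable (μ : Measure X)

/-- The pointwise norm `|v|` of an element of a module. -/
def pnorm {M : Type w} [AddCommGroup M] [Module (L0 μ) M] [PointwiseNorm μ M] (v : M) : L0 μ :=
  PointwiseNorm.pnorm v

/-- The distance `d(v, w) = d_{L⁰}(|v - w|, 0)`. -/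
noncomputable def moduleDist [SigmaFinite μ] {M : Type w} [AddCommGroup M] [Module (L0 μ) M]
    [PointwiseNorm μ M] (v w : M) : ℝ :=
  L0.dist μ (pnorm μ (v - w)) 0

section metric

variable {M : Type w} [AddCommGroup M] [Module (L0 μ) M] [PointwiseNorm μ M]

theorem ae_toFinite_iff [SigmaFinite μ] {p : X → Prop} : (∀ᵐ x ∂μ.toFinite, p x) ↔ ∀ᵐ x ∂μ, p x := by
  rw [ae_toFinite]

theorem pnorm_nonneg_ae (v : M) : ∀ᵐ x ∂μ, 0 ≤ pnorm μ v x := by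
  have h := AEEqFun.coeFn_le.2 (PointwiseNorm.pnorm_nonneg (μ := μ) v)
  filter_upwards [h, AEEqFun.coeFn_zero (α := X) (μ := μ) (β := ℝ)] with x h1 h2
  rw [h2] at h1
  exact h1

theorem pnorm_neg (v : M) : pnorm μ (-v) = pnorm μ v := by
  have h := PointwiseNorm.pnorm_smul (μ := μ) (-1 : L0 μ) v
  rw [neg_one_smul] at h
  rw [pnorm, h, abs_neg]
  have h1 : |(1 : L0 μ)| = 1 := by
    apply AEEqFun.ext
    filter_upwards [AEEqFun.coeFn_abs (1 : L0 μ), AEEqFun.coeFn_one (α := X) (μ := μ) (β := ℝ)]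
      with x h1 h2
    rw [h1, h2]
    simp
  rw [h1, one_mul]
  rfl

variable [SigmaFinite μ]

theorem moduleDist_eq (v w : M) :
    moduleDist μ v w = ∫ x, min (pnorm μ (v - w) x) 1 ∂μ.toFinite := by
  apply integral_congr_ae
  rw [Filter.EventuallyEq, ae_toFinite_iff]
  filter_upwards [pnorm_nonneg_ae μ (v - w), AEEqFun.coeFn_zero (α := X) (μ := μ) (β := ℝ)]
    with x h1 h2
  rw [h2, Pi.zero_apply, sub_zero, abs_of_nonneg h1]

theorem integrable_min_pnorm (v : M) : Integrable (fun x => min (pnorm μ v x) 1) μ.toFinite := by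
  apply Integrable.of_bound (C := 1)
  · exact ((pnorm μ v).stronglyMeasurable.aestronglyMeasurable).inf aestronglyMeasurable_const
  · rw [ae_toFinite_iff]
    filter_upwards [pnorm_nonneg_ae μ v] with x h1
    rw [Real.norm_of_nonneg (le_min h1 zero_le_one)]
    exact min_le_right _ _

/-- The distance `moduleDist` is a metric. -/
@[reducible]
noncomputable def moduleMetric (μ : Measure X) [SigmaFinite μ] (M : Type w) [AddCommGroup M]
    [Module (L0 μ) M] [PointwiseNorm μ M] : MetricSpace M where
  dist := moduleDist μ
  dist_self v := by
    have h : pnorm μ (0 : M) = 0 := (PointwiseNorm.pnorm_eq_zero_iff (μ := μ) (0 : M)).2 rfl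
    simp [moduleDist, L0.dist, h]
  dist_comm v w := by
    unfold moduleDist
    rw [← neg_sub, pnorm_neg]
  dist_triangle u v w := by
    simp only [moduleDist_eq]
    rw [← integral_add (integrable_min_pnorm μ _) (integrable_min_pnorm μ _)]
    apply integral_mono_ae (integrable_min_pnorm μ _)
      ((integrable_min_pnorm μ _).add (integrable_min_pnorm μ _))
    rw [Filter.EventuallyLE, ae_toFinite_iff]
    have h := PointwiseNorm.pnorm_add_le (μ := μ) (u - v) (v - w)
    rw [sub_add_sub_cancel] at h
    filter_upwards [AEEqFun.coeFn_le.2 h, pnorm_nonneg_ae μ (u - v), pnorm_nonneg_ae μ (v - w),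
      AEEqFun.coeFn_add (pnorm μ (u - v)) (pnorm μ (v - w))] with x h1 h2 h3 h4
    replace h1 : pnorm μ (u - w) x ≤ pnorm μ (u - v) x + pnorm μ (v - w) x := by
      rw [← Pi.add_apply, ← h4]
      exact h1
    simp only [Pi.add_apply]
    rcases le_total (pnorm μ (u - v) x) 1 with h5 | h5 <;>
    rcases le_total (pnorm μ (v - w) x) 1 with h6 | h6 <;>
    simp only [min_eq_left, min_eq_right, h5, h6]
    · exact (min_le_left _ _).trans h1
    all_goals exact (min_le_right _ _).trans (by linarith)
  eq_of_dist_eq_zero {v w} h := by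
    change moduleDist μ v w = 0 at h
    rw [moduleDist_eq, integral_eq_zero_iff_of_nonneg_ae _ (integrable_min_pnorm μ _)] at h
    · rw [← sub_eq_zero, ← PointwiseNorm.pnorm_eq_zero_iff (μ := μ)]
      apply AEEqFun.ext
      rw [Filter.EventuallyEq, ae_toFinite_iff] at h
      filter_upwards [h, AEEqFun.coeFn_zero (α := X) (μ := μ) (β := ℝ)] with x h1 h2
      rw [h2]
      simp only [Pi.zero_apply] at *
      rcases min_choice (pnorm μ (v - w) x) 1 with h3 | h3
      · rw [h3] at h1
        exact h1
      · rw [h3] at h1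
        exact absurd h1 one_ne_zero
    · rw [Filter.EventuallyLE, ae_toFinite_iff]
      filter_upwards [pnorm_nonneg_ae μ (v - w)] with x h1
      exact le_min h1 zero_le_one

end metric

/-- A normed `L⁰(μ)`-module: an algebraic `L⁰(μ)`-module with a pointwise norm whose associated
distance is complete. -/
structure NormedL0Module [SigmaFinite μ] where
  carrier : Type w
  [addCommGroup : AddCommGroup carrier]
  [module : Module (L0 μ) carrier]
  [pointwiseNorm : PointwiseNorm μ carrier]
  complete : @CompleteSpace carrier (moduleMetric μ carrier).toUniformSpace

namespace NormedL0Module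

variable {μ} [SigmaFinite μ]

instance : CoeSort (NormedL0Module.{u, w} μ) (Type w) := ⟨carrier⟩

attribute [instance] addCommGroup module pointwiseNorm

noncomputable instance (M : NormedL0Module.{u, w} μ) : MetricSpace M := moduleMetric μ M

/-- A morphism of normed `L⁰(μ)`-modules: an `L⁰(μ)`-linear contraction. -/
@[ext]
structure Hom (M N : NormedL0Module.{u, w} μ) where
  toLin : M →ₗ[L0 μ] N
  pnorm_le : ∀ v : M, pnorm μ (toLin v) ≤ pnorm μ v

/-- The category of normed `L⁰(μ)`-modules. -/
noncomputable instance : Category (NormedL0Module.{u, w} μ) where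
  Hom := Hom
  id M := ⟨LinearMap.id, fun _ => le_rfl⟩
  comp f g := ⟨g.toLin ∘ₗ f.toLin, fun v => (g.pnorm_le _).trans (f.pnorm_le v)⟩

end NormedL0Module

/-- `M` is countably-generated: the `L⁰(μ)`-submodule spanned by some countable set is dense. -/
def IsCountablyGenerated [SigmaFinite μ] : ObjectProperty (NormedL0Module.{u, w} μ) :=
  fun M => ∃ C : Set M, C.Countable ∧ Dense (Submodule.span (L0 μ) C : Set M)

/-- `M` is separable: its associated metric space is separable. -/
def IsSeparableModule [SigmaFinite μ] : ObjectProperty (NormedL0Module.{u, w} μ) :=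
  fun M => SeparableSpace M

/-- The category of countably-generated normed `L⁰(μ)`-modules. -/
abbrev NModCG [SigmaFinite μ] := (IsCountablyGenerated.{u, w} μ).FullSubcategory

/-- The category of separable normed `L⁰(μ)`-modules. -/
abbrev NModS [SigmaFinite μ] := (IsSeparableModule.{u, w} μ).FullSubcategory

/-- A measure space is separable if, for some finite measure `ν` with the same null sets, some
countable family of measurable sets is dense among the measurable sets for `ν (A ∆ B)`. -/
def IsSeparableMeasureSpace : Prop :=
  ∃ ν : Measure X, IsFiniteMeasure ν ∧ μ ≪ ν ∧ ν ≪ μ ∧ MeasureTheory.IsSeparable ν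

end L0

/-- Every (real) separable Banach space embeds linearly and isometrically into `𝔹`. Separable
Banach spaces have at most the cardinality of the continuum, so the universe `w` is immaterial. -/
def IsUniversal (𝔹 : Type v) [NormedAddCommGroup 𝔹] [NormedSpace ℝ 𝔹] : Prop :=
  ∀ (E : Type w) [NormedAddCommGroup E] [NormedSpace ℝ E] [CompleteSpace E] [SeparableSpace E],
    Nonempty (E →ₗᵢ[ℝ] 𝔹)

section bundles

variable {X : Type u} [MeasurableSpace X]
variable {𝔹 : Type v} [NormedAddCommGroup 𝔹] [NormedSpace ℝ 𝔹]

/-- A separable Banach `𝔹`-bundle over `X`: a weakly measurable correspondence from `X` to `𝔹`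
whose values are closed linear subspaces. The measure `μ` is recorded in the type only because the
morphisms depend on it. -/
structure SepBanachBundle (μ : Measure X) (𝔹 : Type v) [NormedAddCommGroup 𝔹]
    [NormedSpace ℝ 𝔹] where
  fiber : X → ClosedSubmodule ℝ 𝔹
  weaklyMeasurable : ∀ U : Set 𝔹, IsOpen U →
    MeasurableSet {x | ((fiber x : Set 𝔹) ∩ U).Nonempty}

namespace SepBanachBundle

variable {μ : Measure X}

/-- The total space `TE ⊆ X × 𝔹`, with the σ-algebra induced by `Σ ⊗ Borel(𝔹)`. -/
def total (E : SepBanachBundle μ 𝔹) : Set (X × 𝔹) := {p | p.2 ∈ E.fiber p.1}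

variable [MeasurableSpace 𝔹]

/-- A pre-morphism `E → F`, given by its restrictions to the fibers: linear contractions
`E(x) → F(x)` such that `(x, v) ↦ (x, φ_x v)` is measurable from `TE` to `TF`. -/
@[ext]
structure PreHom (E F : SepBanachBundle μ 𝔹) where
  toLin : ∀ x, E.fiber x →ₗ[ℝ] F.fiber x
  contraction : ∀ x (v : E.fiber x), ‖(toLin x v : 𝔹)‖ ≤ ‖(v : 𝔹)‖
  measurable : Measurable
    (fun p : E.total => (⟨(p.1.1, toLin p.1.1 ⟨p.1.2, p.2⟩), (toLin p.1.1 ⟨p.1.2, p.2⟩).2⟩ :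
      F.total))

/-- The identity pre-morphism. -/
def PreHom.id (E : SepBanachBundle μ 𝔹) : PreHom E E where
  toLin _ := LinearMap.id
  contraction _ _ := le_rfl
  measurable := measurable_id

/-- The fiberwise composition of pre-morphisms. -/
def PreHom.comp {E F G : SepBanachBundle μ 𝔹} (f : PreHom E F) (g : PreHom F G) : PreHom E G where
  toLin x := g.toLin x ∘ₗ f.toLin x
  contraction x v := (g.contraction x _).trans (f.contraction x v)
  measurable := g.measurable.comp f.measurable

/-- Pre-morphisms are equivalent if they agree on all fibers outside a null measurable set. -/
instance preHomSetoid (E F : SepBanachBundle μ 𝔹) : Setoid (PreHom E F) where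
  r f g := ∃ N : Set X, MeasurableSet N ∧ μ N = 0 ∧ ∀ x, x ∉ N → f.toLin x = g.toLin x
  iseqv :=
    { refl := fun _ => ⟨∅, MeasurableSet.empty, measure_empty, fun _ _ => rfl⟩
      symm := fun ⟨N, h1, h2, h3⟩ => ⟨N, h1, h2, fun x hx => (h3 x hx).symm⟩
      trans := fun ⟨N, h1, h2, h3⟩ ⟨N', h1', h2', h3'⟩ =>
        ⟨N ∪ N', h1.union h1', measure_union_null h2 h2', fun x hx =>
          (h3 x fun h => hx (Or.inl h)).trans (h3' x fun h => hx (Or.inr h))⟩ }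

/-- The category of separable Banach `𝔹`-bundles, whose morphisms are equivalence classes of
pre-morphisms. -/
instance : Category (SepBanachBundle μ 𝔹) where
  Hom E F := Quotient (preHomSetoid E F)
  id E := ⟦PreHom.id E⟧
  comp f g := Quotient.map₂ PreHom.comp
    (by
      rintro f f' ⟨N, h1, h2, h3⟩ g g' ⟨N', h1', h2', h3'⟩
      refine ⟨N ∪ N', h1.union h1', measure_union_null h2 h2', fun x hx => ?_⟩
      simp only [PreHom.comp]
      rw [h3 x fun h => hx (Or.inl h), h3' x fun h => hx (Or.inr h)]) f g
  id_comp f := by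
    induction f using Quotient.inductionOn
    rfl
  comp_id f := by
    induction f using Quotient.inductionOn
    rfl
  assoc f g h := by
    induction f using Quotient.inductionOn
    induction g using Quotient.inductionOn
    induction h using Quotient.inductionOn
    rfl

end SepBanachBundle

end bundles

section sections

variable {X : Type u} [MeasurableSpace X] {μ : Measure X}
variable {𝔹 : Type v} [NormedAddCommGroup 𝔹] [NormedSpace ℝ 𝔹] [SeparableSpace 𝔹]
  [MeasurableSpace 𝔹] [BorelSpace 𝔹]

/-- The vector space of sections of `E`: measurable maps `s : X → 𝔹` with `s x ∈ E(x)` for every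
`x`. -/
def Sections (E : SepBanachBundle μ 𝔹) : Submodule ℝ (X → 𝔹) where
  carrier := {s | Measurable s ∧ ∀ x, s x ∈ E.fiber x}
  add_mem' {s t} hs ht := by
    have := UniformSpace.secondCountable_of_separable 𝔹
    exact ⟨hs.1.add ht.1, fun x => (E.fiber x).toSubmodule.add_mem (hs.2 x) (ht.2 x)⟩
  zero_mem' := ⟨measurable_const, fun x => (E.fiber x).toSubmodule.zero_mem⟩
  smul_mem' c s hs := by
    have := UniformSpace.secondCountable_of_separable 𝔹
    exact ⟨hs.1.const_smul c, fun x => (E.fiber x).toSubmodule.smul_mem c (hs.2 x)⟩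

/-- The sections that vanish almost everywhere. -/
def nullSections (E : SepBanachBundle μ 𝔹) : Submodule ℝ (Sections E) where
  carrier := {s | ∀ᵐ x ∂μ, (s : X → 𝔹) x = 0}
  add_mem' {s t} hs ht := by
    rw [Set.mem_ofPred_eq] at *
    filter_upwards [hs, ht] with x h1 h2
    simp [h1, h2]
  zero_mem' := by
    rw [Set.mem_ofPred_eq]
    exact Eventually.of_forall fun _ => rfl
  smul_mem' c s hs := by
    rw [Set.mem_ofPred_eq] at *
    filter_upwards [hs] with x h1
    simp [h1]

/-- The space `Γ(E)` of sections of `E` up to a.e. equality. -/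
def Gam (E : SepBanachBundle μ 𝔹) : Type (max u v) := Sections E ⧸ nullSections E

namespace Gam

variable {E F : SepBanachBundle μ 𝔹}

instance : AddCommGroup (Gam E) := inferInstanceAs (AddCommGroup (Sections E ⧸ nullSections E))

/-- The class of a section. -/
def mk (s : Sections E) : Gam E := Submodule.Quotient.mk s

theorem mk_surj (s : Gam E) : ∃ t, mk t = s := Submodule.Quotient.mk_surjective _ s

theorem mk_eq_iff {s t : Sections E} :
    mk s = mk t ↔ (s : X → 𝔹) =ᵐ[μ] (t : X → 𝔹) := by
  refine (Submodule.Quotient.eq _).trans ?_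
  constructor
  · intro h
    filter_upwards [h] with x hx
    exact sub_eq_zero.1 hx
  · intro h
    have : ∀ᵐ x ∂μ, ((s - t : Sections E) : X → 𝔹) x = 0 := by
      filter_upwards [h] with x hx
      exact sub_eq_zero.2 hx
    exact this

theorem mk_add (s t : Sections E) : mk (s + t) = mk s + mk t := rfl

theorem mk_sub (s t : Sections E) : mk (s - t) = mk s - mk t := rfl

/-- The product of a section and (the measurable representative of) an element of `L⁰(μ)`. -/
noncomputable def smulSection (f : L0 μ) (s : Sections E) : Sections E :=
  ⟨fun x => f x • (s : X → 𝔹) x, by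
    have := UniformSpace.secondCountable_of_separable 𝔹
    exact ⟨f.measurable.smul s.2.1, fun x => (E.fiber x).toSubmodule.smul_mem _ (s.2.2 x)⟩⟩

noncomputable instance : SMul (L0 μ) (Gam E) where
  smul f := Quotient.lift (fun s => mk (smulSection f s)) (by
    intro s t h
    have h' : (s : X → 𝔹) =ᵐ[μ] (t : X → 𝔹) := mk_eq_iff.1 (Quotient.sound h)
    rw [mk_eq_iff]
    filter_upwards [h'] with x hx
    simp [smulSection, hx])

theorem smul_mk (f : L0 μ) (s : Sections E) : f • mk s = mk (smulSection f s) := rfl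

/-- The pointwise `L⁰(μ)`-module structure on `Γ(E)`. -/
noncomputable instance : Module (L0 μ) (Gam E) where
  one_smul s := by
    obtain ⟨s, rfl⟩ := mk_surj s
    rw [smul_mk, mk_eq_iff]
    filter_upwards [AEEqFun.coeFn_one (α := X) (μ := μ) (β := ℝ)] with x h
    simp [smulSection, h]
  mul_smul f g s := by
    obtain ⟨s, rfl⟩ := mk_surj s
    rw [smul_mk, smul_mk, smul_mk, mk_eq_iff]
    filter_upwards [AEEqFun.coeFn_mul f g] with x h
    simp [smulSection, h, mul_smul]
  smul_zero f := by
    change f • mk 0 = mk 0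
    rw [smul_mk, mk_eq_iff]
    exact Eventually.of_forall fun x => by simp [smulSection]
  smul_add f s t := by
    obtain ⟨s, rfl⟩ := mk_surj s
    obtain ⟨t, rfl⟩ := mk_surj t
    rw [← mk_add, smul_mk, smul_mk, smul_mk, ← mk_add, mk_eq_iff]
    exact Eventually.of_forall fun x => by simp [smulSection]
  add_smul f g s := by
    obtain ⟨s, rfl⟩ := mk_surj s
    rw [smul_mk, smul_mk, smul_mk, ← mk_add, mk_eq_iff]
    filter_upwards [AEEqFun.coeFn_add f g] with x h
    simp [smulSection, h, add_smul]
  zero_smul s := by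
    obtain ⟨s, rfl⟩ := mk_surj s
    change _ = mk 0
    rw [smul_mk, mk_eq_iff]
    filter_upwards [AEEqFun.coeFn_zero (α := X) (μ := μ) (β := ℝ)] with x h
    simp [smulSection, h]

/-- The class of `x ↦ ‖s x‖`. -/
noncomputable def normSection (s : Sections E) : L0 μ :=
  AEEqFun.mk (fun x => ‖(s : X → 𝔹) x‖) s.2.1.norm.aestronglyMeasurable

theorem coeFn_normSection (s : Sections E) :
    normSection s =ᵐ[μ] fun x => ‖(s : X → 𝔹) x‖ := AEEqFun.coeFn_mk _ _

/-- The pointwise norm on `Γ(E)`. -/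
noncomputable instance : PointwiseNorm μ (Gam E) where
  pnorm := Quotient.lift normSection (by
    intro s t h
    have h' : (s : X → 𝔹) =ᵐ[μ] (t : X → 𝔹) := mk_eq_iff.1 (Quotient.sound h)
    refine AEEqFun.mk_eq_mk.2 ?_
    filter_upwards [h'] with x hx
    rw [hx])
  pnorm_nonneg s := by
    obtain ⟨s, rfl⟩ := mk_surj s
    change 0 ≤ normSection s
    rw [← AEEqFun.coeFn_le]
    filter_upwards [coeFn_normSection s, AEEqFun.coeFn_zero (α := X) (μ := μ) (β := ℝ)]
      with x h1 h2
    rw [h1, h2]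
    exact norm_nonneg _
  pnorm_eq_zero_iff s := by
    obtain ⟨s, rfl⟩ := mk_surj s
    change normSection s = 0 ↔ mk s = mk 0
    rw [mk_eq_iff]
    constructor
    · intro h
      filter_upwards [coeFn_normSection s, AEEqFun.coeFn_zero (α := X) (μ := μ) (β := ℝ)]
        with x h1 h2
      rw [h, h2] at h1
      exact norm_eq_zero.1 h1.symm
    · intro h
      apply AEEqFun.ext
      filter_upwards [coeFn_normSection s, AEEqFun.coeFn_zero (α := X) (μ := μ) (β := ℝ), h]
        with x h1 h2 h3
      rw [h1, h2, h3]
      simp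
  pnorm_add_le s t := by
    obtain ⟨s, rfl⟩ := mk_surj s
    obtain ⟨t, rfl⟩ := mk_surj t
    change normSection (s + t) ≤ normSection s + normSection t
    rw [← AEEqFun.coeFn_le]
    filter_upwards [coeFn_normSection s, coeFn_normSection t, coeFn_normSection (s + t),
      AEEqFun.coeFn_add (normSection s) (normSection t)] with x h1 h2 h3 h4
    rw [h3, h4, Pi.add_apply, h1, h2]
    exact norm_add_le _ _
  pnorm_smul f s := by
    obtain ⟨s, rfl⟩ := mk_surj s
    change normSection (smulSection f s) = |f| * normSection s
    apply AEEqFun.ext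
    filter_upwards [coeFn_normSection s, coeFn_normSection (smulSection f s),
      AEEqFun.coeFn_mul |f| (normSection s), AEEqFun.coeFn_abs f] with x h1 h2 h3 h4
    rw [h2, h3, Pi.mul_apply, h4, h1]
    simp [smulSection, norm_smul]

theorem pnorm_mk (s : Sections E) : pnorm μ (mk s) = normSection s := rfl

theorem moduleDist_mk [SigmaFinite μ] (s t : Sections E) :
    moduleDist μ (mk s) (mk t) =
      ∫ x, min ‖(s : X → 𝔹) x - (t : X → 𝔹) x‖ 1 ∂μ.toFinite := by
  rw [moduleDist_eq, ← mk_sub, pnorm_mk]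
  apply integral_congr_ae
  rw [Filter.EventuallyEq, ae_toFinite_iff]
  filter_upwards [coeFn_normSection (s - t)] with x h
  rw [h]
  rfl

/-- The distance on `Γ(E)` is complete. -/
theorem complete [CompleteSpace 𝔹] [SigmaFinite μ] (E : SepBanachBundle μ 𝔹) :
    @CompleteSpace (Gam E) (moduleMetric μ (Gam E)).toUniformSpace := by
  have := UniformSpace.secondCountable_of_separable 𝔹
  let _ : MetricSpace (Gam E) := moduleMetric μ (Gam E)
  refine Metric.complete_of_convergent_controlled_sequences (fun n => (1 / 2 : ℝ) ^ n)
    (fun n => by positivity) ?_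
  intro u hu
  choose s hs using fun n => mk_surj (u n)
  have hmeas : ∀ n, Measurable (s n : X → 𝔹) := fun n => (s n).2.1
  have hD : ∀ n, Measurable fun x => min ‖(s (n + 1) : X → 𝔹) x - (s n : X → 𝔹) x‖ 1 :=
    fun n => (((hmeas (n + 1)).sub (hmeas n)).norm).min measurable_const
  have hsum : ∀ᵐ x ∂μ.toFinite,
      Summable fun n => min ‖(s (n + 1) : X → 𝔹) x - (s n : X → 𝔹) x‖ 1 := by
    have h1 : ∫⁻ x, ∑' n, ENNReal.ofReal (min ‖(s (n + 1) : X → 𝔹) x - (s n : X → 𝔹) x‖ 1)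
        ∂μ.toFinite ≠ ⊤ := by
      rw [lintegral_tsum fun n => (hD n).ennreal_ofReal.aemeasurable]
      have h2 : ∀ n, ∫⁻ x, ENNReal.ofReal (min ‖(s (n + 1) : X → 𝔹) x - (s n : X → 𝔹) x‖ 1)
          ∂μ.toFinite ≤ ENNReal.ofReal ((1 / 2 : ℝ) ^ n) := by
        intro n
        rw [← ofReal_integral_eq_lintegral_ofReal]
        · apply ENNReal.ofReal_le_ofReal
          rw [← moduleDist_mk, hs, hs]
          exact (hu n (n + 1) n (Nat.le_succ n) le_rfl).le
        · refine Integrable.of_bound (hD n).aestronglyMeasurable 1 (Eventually.of_forall ?_)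
          intro x
          rw [Real.norm_of_nonneg (le_min (norm_nonneg _) zero_le_one)]
          exact min_le_right _ _
        · exact Eventually.of_forall fun x => le_min (norm_nonneg _) zero_le_one
      refine ne_top_of_le_ne_top ?_ (ENNReal.tsum_le_tsum h2)
      exact (summable_geometric_two).tsum_ofReal_ne_top
    filter_upwards [ae_lt_top' (by
      exact AEMeasurable.tsum fun n => (hD n).ennreal_ofReal.aemeasurable) h1] with x hx
    have h3 := ENNReal.summable_toReal hx.ne
    simpa only [ENNReal.toReal_ofReal (le_min (norm_nonneg _) zero_le_one)] using h3
  have hconv : ∀ᵐ x ∂μ, ∃ c, Tendsto (fun n => (s n : X → 𝔹) x) atTop (𝓝 c) := by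
    rw [← ae_toFinite_iff]
    filter_upwards [hsum] with x hx
    apply cauchySeq_tendsto_of_complete
    apply cauchySeq_of_summable_dist
    have h4 := (hx.tendsto_atTop_zero).eventually_lt_const zero_lt_one
    refine Summable.of_norm_bounded_eventually_nat hx ?_
    filter_upwards [h4] with n hn
    rw [Real.norm_of_nonneg dist_nonneg, dist_comm, dist_eq_norm]
    rcases min_lt_iff.1 hn with h5 | h5
    · rw [min_eq_left h5.le]
    · exact absurd h5 (lt_irrefl _)
  set A : Set X := {x | ∃ c, Tendsto (fun n => (s n : X → 𝔹) x) atTop (𝓝 c)} with hA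
  have hAm : MeasurableSet A := measurableSet_exists_tendsto hmeas
  have hlim : ∀ x, ∃ c, Tendsto (fun n => A.indicator (s n : X → 𝔹) x) atTop (𝓝 c) := by
    intro x
    by_cases hx : x ∈ A
    · simp only [Set.indicator_of_mem hx]
      exact hx
    · exact ⟨0, by simp only [Set.indicator_of_notMem hx]; exact tendsto_const_nhds⟩
  choose t ht using hlim
  have htm : Measurable t :=
    measurable_of_tendsto_metrizable (fun n => (hmeas n).indicator hAm) (tendsto_pi_nhds.2 ht)
  have htE : ∀ x, t x ∈ E.fiber x := by
    intro x
    refine (E.fiber x).isClosed.mem_of_tendsto (ht x) (Eventually.of_forall fun n => ?_)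
    by_cases hx : x ∈ A
    · rw [Set.indicator_of_mem hx]
      exact (s n).2.2 x
    · rw [Set.indicator_of_notMem hx]
      exact (E.fiber x).toSubmodule.zero_mem
  refine ⟨mk ⟨t, htm, htE⟩, ?_⟩
  rw [tendsto_iff_dist_tendsto_zero]
  have hd : ∀ n, dist (u n) (mk ⟨t, htm, htE⟩) =
      ∫ x, min ‖(s n : X → 𝔹) x - t x‖ 1 ∂μ.toFinite := by
    intro n
    rw [← hs n]
    exact moduleDist_mk _ _
  simp only [hd]
  have h0 : (0 : ℝ) = ∫ _x : X, (0 : ℝ) ∂μ.toFinite := by simp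
  rw [h0]
  refine tendsto_integral_of_dominated_convergence (fun _ => 1) ?_ (integrable_const 1) ?_ ?_
  · intro n
    exact ((((hmeas n).sub htm).norm).min measurable_const).aestronglyMeasurable
  · intro n
    refine Eventually.of_forall fun x => ?_
    rw [Real.norm_of_nonneg (le_min (norm_nonneg _) zero_le_one)]
    exact min_le_right _ _
  · rw [ae_toFinite_iff]
    filter_upwards [hconv] with x hx
    have h6 := ht x
    simp only [Set.indicator_of_mem (show x ∈ A from hx)] at h6
    have h7 : Tendsto (fun n => ‖(s n : X → 𝔹) x - t x‖) atTop (𝓝 0) :=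
      tendsto_iff_norm_sub_tendsto_zero.1 h6
    have h8 := h7.min (tendsto_const_nhds (x := (1 : ℝ)))
    simpa using h8

/-- The action of a pre-morphism on sections: `x ↦ φ_x (s x)`. -/
def mapSection (f : SepBanachBundle.PreHom E F) (s : Sections E) : Sections F :=
  ⟨fun x => f.toLin x ⟨(s : X → 𝔹) x, s.2.2 x⟩, by
    refine ⟨?_, fun x => (f.toLin x _).2⟩
    have h : Measurable fun x => (⟨(x, (s : X → 𝔹) x), s.2.2 x⟩ : E.total) :=
      (measurable_id.prodMk s.2.1).subtype_mk
    exact (measurable_snd.comp measurable_subtype_coe).comp (f.measurable.comp h)⟩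

/-- The action of a pre-morphism on classes of sections. -/
def preMap (f : SepBanachBundle.PreHom E F) : Gam E → Gam F :=
  Quotient.lift (fun s => mk (mapSection f s)) (by
    intro s t h
    have h' : (s : X → 𝔹) =ᵐ[μ] (t : X → 𝔹) := mk_eq_iff.1 (Quotient.sound h)
    rw [mk_eq_iff]
    filter_upwards [h'] with x hx
    simp [mapSection, hx])

theorem preMap_mk (f : SepBanachBundle.PreHom E F) (s : Sections E) :
    preMap f (mk s) = mk (mapSection f s) := rfl

/-- `preMap` as an `L⁰(μ)`-linear map. -/
noncomputable def preMapLin (f : SepBanachBundle.PreHom E F) : Gam E →ₗ[L0 μ] Gam F where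
  toFun := preMap f
  map_add' s t := by
    obtain ⟨s, rfl⟩ := mk_surj s
    obtain ⟨t, rfl⟩ := mk_surj t
    rw [← mk_add, preMap_mk, preMap_mk, preMap_mk, ← mk_add, mk_eq_iff]
    refine Eventually.of_forall fun x => ?_
    exact congrArg Subtype.val
      ((f.toLin x).map_add ⟨(s : X → 𝔹) x, s.2.2 x⟩ ⟨(t : X → 𝔹) x, t.2.2 x⟩)
  map_smul' g s := by
    obtain ⟨s, rfl⟩ := mk_surj s
    rw [RingHom.id_apply, smul_mk, preMap_mk, preMap_mk, smul_mk, mk_eq_iff]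
    refine Eventually.of_forall fun x => ?_
    exact congrArg Subtype.val ((f.toLin x).map_smul (g x) ⟨(s : X → 𝔹) x, s.2.2 x⟩)

end Gam

variable [CompleteSpace 𝔹] [SigmaFinite μ]

/-- `Γ(E)` as a normed `L⁰(μ)`-module. -/
noncomputable def GamModule (E : SepBanachBundle μ 𝔹) : NormedL0Module.{u, max u v} μ where
  carrier := Gam E
  complete := Gam.complete E

/-- `Γ(φ)` for a pre-morphism `φ`. -/
noncomputable def preGamMap {E F : SepBanachBundle μ 𝔹} (f : SepBanachBundle.PreHom E F) :
    NormedL0Module.Hom (GamModule E) (GamModule F) where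
  toLin := Gam.preMapLin f
  pnorm_le s := by
    obtain ⟨s, rfl⟩ := Gam.mk_surj s
    change Gam.normSection (Gam.mapSection f s) ≤ Gam.normSection s
    rw [← AEEqFun.coeFn_le]
    filter_upwards [Gam.coeFn_normSection s, Gam.coeFn_normSection (Gam.mapSection f s)]
      with x h1 h2
    rw [h1, h2]
    exact f.contraction x _

variable (μ 𝔹) in
/-- The section functor `Γ`, with values in all normed `L⁰(μ)`-modules. -/
noncomputable def sectionFunctor : SepBanachBundle μ 𝔹 ⥤ NormedL0Module.{u, max u v} μ where
  obj E := GamModule E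
  map {E F} := Quotient.lift preGamMap (by
    rintro f g ⟨N, -, hN, h⟩
    apply NormedL0Module.Hom.ext
    apply LinearMap.ext
    intro s
    obtain ⟨s, rfl⟩ := Gam.mk_surj s
    refine Gam.mk_eq_iff.2 ?_
    filter_upwards [measure_eq_zero_iff_ae_notMem.1 hN] with x hx
    simp [Gam.mapSection, h x hx])
  map_id E := by
    apply NormedL0Module.Hom.ext
    apply LinearMap.ext
    intro s
    obtain ⟨s, rfl⟩ := Gam.mk_surj s
    rfl
  map_comp f g := by
    induction f using Quotient.inductionOn
    induction g using Quotient.inductionOn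
    apply NormedL0Module.Hom.ext
    apply LinearMap.ext
    intro s
    obtain ⟨s, rfl⟩ := Gam.mk_surj s
    rfl

end sections

end SerreSwan

/-!
The section functor is full, faithful and essentially surjective onto the countably generated
modules; every argument reduces an almost everywhere statement to countably many of them.

*Castaing representations.* By the Kuratowski–Ryll-Nardzewski selection theorem
(`exists_dense_measurable_selections`) every bundle has a sequence of sections which is dense in
every fiber. Gluing finitely many of them along measurable sets approximates every section
(`exists_dist_sum_indL0_lt`), so `Γ(E)` is countably generated. If the measure space is separable,
the sets can be taken from a countable family, and `Γ(E)` is separable.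

*Full faithfulness.* A morphism is determined on almost every fiber by its values on such a
sequence. Conversely, a morphism of modules maps the sequence to sections of the target which, for
almost every `x`, satisfy the contraction inequality for all rational combinations, hence for all
real ones; the resulting map extends to the fiber (`exists_contraction_extension`), and measurably
so (`measurable_total_of_fiberwiseDense`).

*Essential surjectivity.* Generators `w i` of pointwise norm at most `1` define, for almost every
`x`, a seminorm `q ↦ |∑ qᵢ wᵢ|(x)` on the finitely supported rational sequences. All such seminorms
are realized, with measurable dependence on the seminorm, by sequences in the continuous functions
on the Cantor set (`exists_cantor_model`): the dual unit ball is a compact subset of the Hilbert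
cube, its preimage in the Cantor set is the image of a retraction which chooses bits greedily, and
this retraction depends measurably on the seminorm, which an arbitrary one need not do. Hence
universality of `𝔹` is needed only once, for a single embedding of the continuous functions on the
Cantor set. The closed spans of these sequences form a bundle. The `L⁰(μ)`-submodule of
`Γ(E) × M` generated by the pairs of corresponding generators relates elements of equal pointwise
norm (`coeFn_pnorm_sum_smul`) and has dense projections, so its closure is the graph of an
isomorphism (`NormedL0Module.nonempty_iso_of_submodule`).
-/

namespace SerreSwan

/-! ### Measurable selections -/

section selection

variable {X : Type*} [MeasurableSpace X]

/-- A recursion with values in a countable type whose steps depend measurably on a parameter has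
measurable iterates: the countably many values of the previous iterate are treated one by one. -/
theorem measurableSet_iterate_eq {ι : Type*} [Countable ι] (F : ℕ → X → ι) (step : ℕ → X → ι → ι)
    (h0 : ∀ s, MeasurableSet {x | F 0 x = s})
    (hstep : ∀ n i s, MeasurableSet {x | step n x i = s})
    (hF : ∀ n x, F (n + 1) x = step n x (F n x)) (n : ℕ) (s : ι) :
    MeasurableSet {x | F n x = s} := by
  induction n generalizing s with
  | zero => exact h0 s
  | succ n ih =>
    have : {x | F (n + 1) x = s} = ⋃ i, {x | F n x = i} ∩ {x | step n x i = s} := by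
      ext x
      simp [hF]
    rw [this]
    exact MeasurableSet.iUnion fun i => (ih i).inter (hstep n i s)

theorem measurableSet_sInf_eq {S : ℕ → Set X} (hS : ∀ i, MeasurableSet (S i)) (m : ℕ) :
    MeasurableSet {x | sInf {i | x ∈ S i} = m} := by
  have : {x | sInf {i | x ∈ S i} = m} =
      (S m ∩ ⋂ j : ℕ, ⋂ _ : j < m, (S j)ᶜ) ∪ ({_x | m = 0} ∩ ⋂ j, (S j)ᶜ) := by
    ext x
    simp only [Set.mem_ofPred_eq, Set.mem_union, Set.mem_inter_iff, Set.mem_iInter,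
      Set.mem_compl_iff]
    constructor
    · rintro rfl
      rcases Set.eq_empty_or_nonempty {i | x ∈ S i} with h | h
      · right
        refine ⟨by rw [h, Nat.sInf_empty], fun j hj => ?_⟩
        exact Set.notMem_empty j (h ▸ hj)
      · exact Or.inl ⟨Nat.sInf_mem h, fun j hj => Nat.notMem_of_lt_sInf hj⟩
    · rintro (⟨h1, h2⟩ | ⟨rfl, h⟩)
      · refine le_antisymm (Nat.sInf_le h1) ?_
        by_contra! hlt
        exact h2 _ hlt (Nat.sInf_mem (s := {i | x ∈ S i}) ⟨m, h1⟩)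
      · have : {i | x ∈ S i} = ∅ := Set.eq_empty_of_forall_notMem h
        rw [this, Nat.sInf_empty]
  rw [this]
  refine ((hS m).inter (MeasurableSet.iInter fun j => MeasurableSet.iInter fun _ =>
    (hS j).compl)).union ((MeasurableSet.const _).inter (MeasurableSet.iInter fun j => (hS j).compl))

variable {Y : Type*} [MetricSpace Y] [CompleteSpace Y] [SeparableSpace Y] [MeasurableSpace Y]
  [BorelSpace Y]

/-- The Kuratowski–Ryll-Nardzewski selection theorem for a weakly measurable correspondence with
nonempty closed values, with a prescribed approximate value: the selection stays close to
`denseSeq Y j` wherever the correspondence meets a small ball around that point. -/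
theorem exists_measurable_selection_near [Nonempty Y] {E : X → Set Y} (hc : ∀ x, IsClosed (E x))
    (hne : ∀ x, (E x).Nonempty) (hE : ∀ U, IsOpen U → MeasurableSet {x | (E x ∩ U).Nonempty})
    (j k : ℕ) :
    ∃ s : X → Y, Measurable s ∧ (∀ x, s x ∈ E x) ∧ ∀ x,
      (E x ∩ Metric.ball (denseSeq Y j) ((1 / 2) ^ k)).Nonempty →
        dist (denseSeq Y j) (s x) ≤ 4 * (1 / 2) ^ k := by
  let d : ℕ → Y := denseSeq Y
  let A : ℕ → ℕ → Set X := fun k i => {x | (E x ∩ Metric.ball (d i) ((1 / 2) ^ k)).Nonempty}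
  have hA : ∀ k i, MeasurableSet (A k i) := fun k i => hE _ Metric.isOpen_ball
  have hpos : ∀ k : ℕ, (0 : ℝ) < (1 / 2) ^ k := fun k => by positivity
  have hnear : ∀ (y : Y) (k : ℕ), ∃ i, dist y (d i) < (1 / 2) ^ k := fun y k =>
    (denseRange_denseSeq Y).exists_dist_lt y (hpos k)
  classical
  -- `F n x` is the index of a point of the dense sequence whose ball of radius `2⁻⁽ᵏ⁺ⁿ⁾` meets
  -- `E x`; the next index is the least one that halves the radius and stays near this point.
  let S : ℕ → ℕ → ℕ → Set X := fun n i i' =>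
    {x | x ∈ A (k + n + 1) i' ∧ dist (d i) (d i') ≤ 2 * (1 / 2) ^ (k + n)}
  have hS : ∀ n i i', MeasurableSet (S n i i') := fun n i i' =>
    (hA _ _).inter (MeasurableSet.const _)
  let F0 : X → ℕ := fun x => if x ∈ A k j then j else sInf {i | x ∈ A k i}
  let F : ℕ → X → ℕ := fun n x => Nat.rec (F0 x) (fun n i => sInf {i' | x ∈ S n i i'}) n
  have hF : ∀ n x, F (n + 1) x = sInf {i' | x ∈ S n (F n x) i'} := fun n x => rfl
  have hFm : ∀ n s, MeasurableSet {x | F n x = s} := by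
    refine measurableSet_iterate_eq F (fun n x i => sInf {i' | x ∈ S n i i'}) ?_ ?_ hF
    · intro s
      have : {x | F 0 x = s} = (A k j ∩ {_x | j = s}) ∪
          ((A k j)ᶜ ∩ {x | sInf {i | x ∈ A k i} = s}) := by
        ext x
        by_cases hx : x ∈ A k j <;> simp [F, F0, hx]
      rw [this]
      exact ((hA _ _).inter (MeasurableSet.const _)).union
        ((hA _ _).compl.inter (measurableSet_sInf_eq (hA k) s))
    · exact fun n i s => measurableSet_sInf_eq (hS n i) s
  have hnext : ∀ n x, x ∈ A (k + n) (F n x) → x ∈ S n (F n x) (F (n + 1) x) := by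
    rintro n x ⟨y, hy, hyb⟩
    obtain ⟨i, hi⟩ := hnear y (k + n + 1)
    refine Nat.sInf_mem (s := {i' | x ∈ S n (F n x) i'}) ⟨i, ⟨y, hy, hi⟩, ?_⟩
    rw [Metric.mem_ball, dist_comm] at hyb
    have h2 : ((1 : ℝ) / 2) ^ (k + n + 1) ≤ (1 / 2) ^ (k + n) :=
      pow_le_pow_of_le_one (by norm_num) (by norm_num) (Nat.le_succ _)
    linarith [dist_triangle (d (F n x)) y (d i)]
  have hinv : ∀ n x, x ∈ A (k + n) (F n x) := by
    intro n x
    induction n with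
    | zero =>
      change x ∈ A k (if x ∈ A k j then j else sInf {i | x ∈ A k i})
      split_ifs with h
      · exact h
      · obtain ⟨y, hy⟩ := hne x
        obtain ⟨i, hi⟩ := hnear y k
        exact Nat.sInf_mem (s := {i | x ∈ A k i}) ⟨i, y, hy, hi⟩
    | succ n ih => exact (hnext n x ih).1
  have hstep : ∀ x n, dist (d (F n x)) (d (F (n + 1) x)) ≤ 2 * (1 / 2) ^ k * (1 / 2) ^ n := by
    intro x n
    rw [mul_assoc, ← pow_add]
    exact (hnext n x (hinv n x)).2
  have hlim : ∀ x, ∃ y, Tendsto (fun n => d (F n x)) atTop (𝓝 y) := fun x =>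
    cauchySeq_tendsto_of_complete (cauchySeq_of_le_geometric _ _ (by norm_num) (hstep x))
  choose s hs using hlim
  refine ⟨s, ?_, fun x => ?_, fun x hx => ?_⟩
  · refine measurable_of_tendsto_metrizable (f := fun n x => d (F n x)) (fun n => ?_)
      (tendsto_pi_nhds.2 hs)
    exact (measurable_from_top (f := d)).comp (measurable_to_countable' fun i => hFm n i)
  · choose y hy hyb using fun n => hinv n x
    refine (hc x).mem_of_tendsto (b := atTop) (f := y) ?_ (Eventually.of_forall hy)
    refine (hs x).congr_dist (squeeze_zero (fun _ => dist_nonneg) (g := fun n => (1 / 2) ^ n)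
      (fun n => ?_) (tendsto_pow_atTop_nhds_zero_of_lt_one (by norm_num) (by norm_num)))
    rw [dist_comm]
    refine (le_of_lt (hyb n)).trans ?_
    exact pow_le_pow_of_le_one (by norm_num) (by norm_num) (Nat.le_add_left _ _)
  · have h := dist_le_of_le_geometric_of_tendsto₀ _ _ (by norm_num) (hstep x) (hs x)
    have hF0 : F 0 x = j := if_pos hx
    rw [hF0] at h
    exact h.trans_eq (by ring)

/-- A weakly measurable correspondence with nonempty closed values is the closure of countably many
measurable selections (a Castaing representation). -/
theorem exists_dense_measurable_selections {E : X → Set Y} (hc : ∀ x, IsClosed (E x))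
    (hne : ∀ x, (E x).Nonempty) (hE : ∀ U, IsOpen U → MeasurableSet {x | (E x ∩ U).Nonempty}) :
    ∃ s : ℕ → X → Y, (∀ n, Measurable (s n)) ∧ (∀ n x, s n x ∈ E x) ∧
      ∀ x, E x ⊆ closure (Set.range fun n => s n x) := by
  rcases isEmpty_or_nonempty X with hX | ⟨⟨x₀⟩⟩
  · exact ⟨fun _ x => (hX.false x).elim, fun _ => measurable_of_empty _,
      fun _ x => (hX.false x).elim, fun x => (hX.false x).elim⟩
  have hY : Nonempty Y := ⟨(hne x₀).some⟩
  choose s hm hs hd using fun p : ℕ × ℕ => exists_measurable_selection_near hc hne hE p.1 p.2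
  refine ⟨fun n => s (Nat.unpair n), fun n => hm _, fun n => hs _, fun x y hy => ?_⟩
  rw [Metric.mem_closure_iff]
  intro ε hε
  obtain ⟨k, hk⟩ := exists_pow_lt_of_lt_one (show 0 < ε / 5 by positivity)
    (show (1 / 2 : ℝ) < 1 by norm_num)
  obtain ⟨j, hj⟩ := (denseRange_denseSeq Y).exists_dist_lt y (ε := (1 / 2) ^ k) (by positivity)
  refine ⟨_, ⟨Nat.pair j k, rfl⟩, ?_⟩
  have h := hd (j, k) x ⟨y, hy, hj⟩
  simp only [Nat.unpair_pair]
  linarith [dist_triangle y (denseSeq Y j) (s (j, k) x)]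

end selection

/-! ### The topology of a normed module -/

section topology

variable {X : Type u} [MeasurableSpace X] {μ : Measure X}

section pnorm

variable {M : Type w} [AddCommGroup M] [Module (L0 μ) M] [PointwiseNorm μ M]

theorem coeFn_pnorm_smul (f : L0 μ) (v : M) :
    pnorm μ (f • v) =ᵐ[μ] fun x => |f x| * pnorm μ v x := by
  have h : pnorm μ (f • v) = |f| * pnorm μ v := PointwiseNorm.pnorm_smul f v
  rw [h]
  filter_upwards [AEEqFun.coeFn_mul |f| (pnorm μ v), AEEqFun.coeFn_abs f] with x h1 h2
  rw [h1, Pi.mul_apply, h2]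

theorem coeFn_pnorm_add_le (v w : M) :
    ∀ᵐ x ∂μ, pnorm μ (v + w) x ≤ pnorm μ v x + pnorm μ w x := by
  filter_upwards [AEEqFun.coeFn_le.2 (PointwiseNorm.pnorm_add_le (μ := μ) v w),
    AEEqFun.coeFn_add (pnorm μ v) (pnorm μ w)] with x h1 h2
  refine (h1.trans_eq h2 :)

theorem coeFn_pnorm_zero : pnorm μ (0 : M) =ᵐ[μ] 0 := by
  have h : pnorm μ (0 : M) = 0 := (PointwiseNorm.pnorm_eq_zero_iff (μ := μ) (0 : M)).2 rfl
  rw [h]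
  exact AEEqFun.coeFn_zero

theorem coeFn_pnorm_sum_le {ι : Type*} (s : Finset ι) (v : ι → M) :
    ∀ᵐ x ∂μ, pnorm μ (∑ i ∈ s, v i) x ≤ ∑ i ∈ s, pnorm μ (v i) x := by
  classical
  induction s using Finset.induction_on with
  | empty =>
    filter_upwards [coeFn_pnorm_zero (μ := μ) (M := M)] with x hx
    simpa using hx.le
  | insert i s hi ih =>
    filter_upwards [ih, coeFn_pnorm_add_le (μ := μ) (v i) (∑ i ∈ s, v i)] with x h1 h2
    rw [Finset.sum_insert hi, Finset.sum_insert hi]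
    linarith

theorem abs_pnorm_sub_pnorm_le (v w : M) :
    ∀ᵐ x ∂μ, |pnorm μ v x - pnorm μ w x| ≤ pnorm μ (v - w) x := by
  have h1 := coeFn_pnorm_add_le (μ := μ) (v - w) w
  have h2 := coeFn_pnorm_add_le (μ := μ) (w - v) v
  rw [sub_add_cancel] at h1 h2
  rw [← neg_sub v w, pnorm_neg] at h2
  filter_upwards [h1, h2] with x h3 h4
  rw [abs_le]
  constructor <;> linarith

end pnorm

/-- A real random variable is tight: it is large only on a set of small measure. -/
theorem exists_measureReal_abs_gt_lt (ν : Measure X) [IsFiniteMeasure ν] {f : X → ℝ}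
    (hf : Measurable f) {ε : ℝ} (hε : 0 < ε) :
    ∃ C : ℝ, 1 ≤ C ∧ ν.real {x | C < |f x|} < ε := by
  have h : Tendsto (fun n : ℕ => ν {x | (n : ℝ) < |f x|}) atTop
      (𝓝 (ν (⋂ n : ℕ, {x | (n : ℝ) < |f x|}))) := by
    refine tendsto_measure_iInter_atTop
      (fun n => (measurableSet_lt measurable_const hf.abs).nullMeasurableSet) ?_
      ⟨0, measure_ne_top _ _⟩
    intro m n hmn x (hx : (n : ℝ) < |f x|)
    exact lt_of_le_of_lt (Nat.cast_le.2 hmn) hx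
  have h0 : (⋂ n : ℕ, {x | (n : ℝ) < |f x|}) = ∅ := by
    refine Set.eq_empty_of_forall_notMem fun x hx => ?_
    obtain ⟨n, hn⟩ := exists_nat_ge |f x|
    exact absurd (Set.mem_iInter.1 hx n) (not_lt.2 hn)
  rw [h0, measure_empty] at h
  have h' := (ENNReal.tendsto_toReal ENNReal.zero_ne_top).comp h
  obtain ⟨n, hn, hn1⟩ := ((h'.eventually (gt_mem_nhds hε)).and (eventually_ge_atTop 1)).exists
  exact ⟨n, by exact_mod_cast hn1, hn⟩

variable [SigmaFinite μ]

namespace NormedL0Module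

variable {M N : NormedL0Module.{u, w} μ}

theorem dist_eq (v w : M) : dist v w = ∫ x, min (pnorm μ (v - w) x) 1 ∂μ.toFinite :=
  moduleDist_eq μ v w

theorem dist_eq_of_pnorm_eq {v w : M} {s t : N} (h : pnorm μ (v - w) = pnorm μ (s - t)) :
    dist v w = dist s t := by
  rw [dist_eq, dist_eq, h]

protected theorem dist_add_add_le (v w v' w' : M) :
    dist (v + w) (v' + w') ≤ dist v v' + dist w w' := by
  have h1 : dist (v + w) (v' + w) = dist v v' :=
    dist_eq_of_pnorm_eq (by rw [add_sub_add_right_eq_sub])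
  have h2 : dist (v' + w) (v' + w') = dist w w' :=
    dist_eq_of_pnorm_eq (by rw [add_sub_add_left_eq_sub])
  rw [← h1, ← h2]
  exact dist_triangle _ _ _

protected theorem dist_sum_sum_le {ι : Type*} (s : Finset ι) (v w : ι → M) :
    dist (∑ i ∈ s, v i) (∑ i ∈ s, w i) ≤ ∑ i ∈ s, dist (v i) (w i) := by
  classical
  induction s using Finset.induction_on with
  | empty => simp
  | insert i s hi ih =>
    simp only [Finset.sum_insert hi]
    exact (NormedL0Module.dist_add_add_le _ _ _ _).trans (by gcongr)

instance : ContinuousAdd M where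
  continuous_add := by
    rw [Metric.continuous_iff]
    rintro ⟨v, w⟩ ε hε
    refine ⟨ε / 2, half_pos hε, fun ⟨v', w'⟩ h => ?_⟩
    rw [Prod.dist_eq, max_lt_iff] at h
    refine (NormedL0Module.dist_add_add_le v' w' v w).trans_lt ?_
    linarith [h.1, h.2]

theorem dist_smul_le (f : L0 μ) (v w : M) {C : ℝ} (hC : 1 ≤ C) :
    dist (f • v) (f • w) ≤ C * dist v w + μ.toFinite.real {x | C < |f x|} := by
  have hm : MeasurableSet {x | C < |f x|} := measurableSet_lt measurable_const f.measurable.abs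
  have hi : Integrable ({x | C < |f x|}.indicator (1 : X → ℝ)) μ.toFinite :=
    (integrable_const (1 : ℝ)).indicator hm
  rw [dist_eq, dist_eq, ← integral_const_mul, ← integral_indicator_one hm,
    ← integral_add ((integrable_min_pnorm μ _).const_mul C) hi]
  refine integral_mono_ae (integrable_min_pnorm μ _)
    (((integrable_min_pnorm μ _).const_mul C).add hi) ?_
  rw [Filter.EventuallyLE, ae_toFinite_iff, ← smul_sub]
  filter_upwards [coeFn_pnorm_smul f (v - w), pnorm_nonneg_ae μ (v - w)] with x h1 h2
  have h3 : 0 ≤ C * min (pnorm μ (v - w) x) 1 :=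
    mul_nonneg (by linarith) (le_min h2 zero_le_one)
  rw [h1]
  by_cases hx : C < |f x|
  · rw [Set.indicator_of_mem (show x ∈ {x | C < |f x|} from hx), Pi.one_apply]
    exact (min_le_right _ _).trans (by linarith)
  · rw [Set.indicator_of_notMem (show x ∉ {x | C < |f x|} from hx), add_zero]
    rcases le_total (pnorm μ (v - w) x) 1 with h | h
    · rw [min_eq_left h]
      exact (min_le_left _ _).trans (mul_le_mul_of_nonneg_right (not_lt.1 hx) h2)
    · rw [min_eq_right h]
      exact (min_le_right _ _).trans (by linarith)

instance : ContinuousConstSMul (L0 μ) M where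
  continuous_const_smul f := by
    rw [Metric.continuous_iff]
    intro v ε hε
    obtain ⟨C, hC1, hC⟩ := exists_measureReal_abs_gt_lt μ.toFinite f.measurable (half_pos hε)
    refine ⟨ε / 2 / C, by positivity, fun w h => ?_⟩
    have h1 := dist_smul_le f w v hC1
    rw [lt_div_iff₀ (by linarith)] at h
    linarith

theorem Hom.continuous (f : Hom M N) : Continuous f.toLin := by
  refine (LipschitzWith.of_dist_le_mul (K := 1) fun v w => ?_).continuous
  rw [NNReal.coe_one, one_mul, dist_eq, dist_eq, ← map_sub]
  refine integral_mono_ae (integrable_min_pnorm μ _) (integrable_min_pnorm μ _) ?_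
  rw [Filter.EventuallyLE, ae_toFinite_iff]
  filter_upwards [AEEqFun.coeFn_le.2 (f.pnorm_le (v - w))] with x hx
  exact min_le_min_right 1 hx

/-- Morphisms are determined by their values on a set of generators. -/
theorem Hom.ext_of_dense_span {f g : Hom M N} {C : Set M}
    (hC : Dense (Submodule.span (L0 μ) C : Set M)) (h : ∀ v ∈ C, f.toLin v = g.toLin v) :
    f = g := by
  refine Hom.ext (DFunLike.coe_injective (f.continuous.ext_on hC g.continuous ?_))
  exact fun v hv => LinearMap.eqOn_span h hv

theorem isClosed_pnorm_eq : IsClosed {p : M × N | pnorm μ p.1 = pnorm μ p.2} := by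
  rw [← closure_subset_iff_isClosed]
  intro p hp
  -- The distance in `L⁰(μ)` of the two pointwise norms is at most the distance of `p` to any point
  -- of the set, hence zero.
  set F : X → ℝ := fun x => min |pnorm μ p.1 x - pnorm μ p.2 x| 1 with hF
  have hF0 : ∀ x, 0 ≤ F x := fun x => le_min (abs_nonneg _) zero_le_one
  have hFm : Measurable F :=
    ((pnorm μ p.1).measurable.sub (pnorm μ p.2).measurable).abs.min measurable_const
  have hFi : Integrable F μ.toFinite := by
    refine Integrable.of_bound hFm.aestronglyMeasurable 1 (Eventually.of_forall fun x => ?_)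
    rw [Real.norm_of_nonneg (hF0 x)]
    exact min_le_right _ _
  have hle : ∀ q : M × N, pnorm μ q.1 = pnorm μ q.2 →
      ∫ x, F x ∂μ.toFinite ≤ dist p.1 q.1 + dist p.2 q.2 := by
    intro q hq
    rw [dist_eq, dist_eq, ← integral_add (integrable_min_pnorm μ _) (integrable_min_pnorm μ _)]
    refine integral_mono_ae hFi
      ((integrable_min_pnorm μ _).add (integrable_min_pnorm μ _)) ?_
    rw [Filter.EventuallyLE, ae_toFinite_iff]
    filter_upwards [abs_pnorm_sub_pnorm_le (μ := μ) p.1 q.1,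
      abs_pnorm_sub_pnorm_le (μ := μ) p.2 q.2] with x h1 h2
    rw [hq] at h1
    have h3 : |pnorm μ p.1 x - pnorm μ p.2 x| ≤
        pnorm μ (p.1 - q.1) x + pnorm μ (p.2 - q.2) x := by
      have h4 := abs_sub_le (pnorm μ p.1 x) (pnorm μ q.2 x) (pnorm μ p.2 x)
      rw [abs_sub_comm (pnorm μ q.2 x)] at h4
      linarith
    have h5 := (abs_nonneg _).trans h1
    have h6 := (abs_nonneg _).trans h2
    simp only [F]
    rcases le_total (pnorm μ (p.1 - q.1) x) 1 with h7 | h7 <;>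
    rcases le_total (pnorm μ (p.2 - q.2) x) 1 with h8 | h8 <;>
    simp only [min_eq_left, min_eq_right, h7, h8]
    · exact (min_le_left _ _).trans h3
    all_goals exact (min_le_right _ _).trans (by linarith)
  have hzero : ∫ x, F x ∂μ.toFinite = 0 := by
    refine le_antisymm (le_of_forall_pos_lt_add fun ε hε => ?_) (integral_nonneg hF0)
    obtain ⟨q, hq, hd⟩ := Metric.mem_closure_iff.1 hp (ε / 2) (half_pos hε)
    rw [Prod.dist_eq, max_lt_iff] at hd
    linarith [hle q hq, hd.1, hd.2]
  rw [integral_eq_zero_iff_of_nonneg hF0 hFi, Filter.EventuallyEq, ae_toFinite_iff] at hzero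
  refine AEEqFun.ext ?_
  filter_upwards [hzero] with x hx
  by_contra hne
  have h1 : 0 < |pnorm μ p.1 x - pnorm μ p.2 x| := abs_pos.2 (sub_ne_zero.2 hne)
  have h2 : 0 < F x := lt_min h1 zero_lt_one
  exact h2.ne' hx

/-- A closed relation which is isometric for the pointwise norms is everywhere defined as soon as
it is densely defined. -/
theorem exists_mem_of_dense_fst {G : Submodule (L0 μ) (M × N)} (hc : IsClosed (G : Set (M × N)))
    (hG : ∀ p ∈ G, pnorm μ p.1 = pnorm μ p.2) (hd : Dense (Prod.fst '' (G : Set (M × N))))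
    (v : M) : ∃ s : N, (v, s) ∈ G := by
  have : CompleteSpace N := N.complete
  obtain ⟨p, hpG, hp⟩ : ∃ p : ℕ → M × N, (∀ n, p n ∈ G) ∧
      Tendsto (fun n => (p n).1) atTop (𝓝 v) := by
    obtain ⟨y, hy, hyv⟩ := mem_closure_iff_seq_limit.1 (hd v)
    choose p hpG hp using hy
    exact ⟨p, hpG, by simpa only [hp] using hyv⟩
  have hdist : ∀ m n, dist (p m).2 (p n).2 = dist (p m).1 (p n).1 := fun m n =>
    dist_eq_of_pnorm_eq (hG _ (G.sub_mem (hpG m) (hpG n))).symm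
  have hcauchy : CauchySeq fun n => (p n).2 := by
    have h := hp.cauchySeq
    rw [Metric.cauchySeq_iff] at h ⊢
    simpa only [hdist] using h
  obtain ⟨s, hs⟩ := cauchySeq_tendsto_of_complete hcauchy
  exact ⟨s, hc.mem_of_tendsto (hp.prodMk_nhds hs) (Eventually.of_forall hpG)⟩

/-- Two normed modules are isomorphic if they are related by a submodule of their product which is
isometric for the pointwise norms and has dense projections to both factors. -/
theorem nonempty_iso_of_submodule (G : Submodule (L0 μ) (M × N))
    (hG : ∀ p ∈ G, pnorm μ p.1 = pnorm μ p.2) (h1 : Dense (Prod.fst '' (G : Set (M × N))))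
    (h2 : Dense (Prod.snd '' (G : Set (M × N)))) : Nonempty (M ≅ N) := by
  set H := G.topologicalClosure with hH
  have hc : IsClosed (H : Set (M × N)) := G.isClosed_topologicalClosure
  have hGH : (G : Set (M × N)) ⊆ H := G.le_topologicalClosure
  have hHn : ∀ p ∈ H, pnorm μ p.1 = pnorm μ p.2 := fun p hp =>
    closure_minimal hG isClosed_pnorm_eq hp
  have hfst : ∀ v : M, ∃ s : N, (v, s) ∈ H :=
    exists_mem_of_dense_fst hc hHn (h1.mono (Set.image_mono hGH))
  have hsnd : ∀ s : N, ∃ v : M, (v, s) ∈ H := by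
    let K : Submodule (L0 μ) (N × M) := H.comap (LinearEquiv.prodComm (L0 μ) N M).toLinearMap
    refine exists_mem_of_dense_fst (G := K) (hc.preimage continuous_swap)
      (fun p hp => (hHn p.swap hp).symm) (h2.mono ?_)
    rintro _ ⟨p, hp, rfl⟩
    exact ⟨p.swap, hGH hp, rfl⟩
  let e1 : H ≃ₗ[L0 μ] M := LinearEquiv.ofBijective (LinearMap.fst _ M N ∘ₗ H.subtype) <| by
    constructor
    · rw [← LinearMap.ker_eq_bot, LinearMap.ker_eq_bot']
      rintro ⟨⟨v, s⟩, hp⟩ (rfl : v = 0)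
      have h := hHn _ hp
      have h0 : pnorm μ (0 : M) = 0 := (PointwiseNorm.pnorm_eq_zero_iff (μ := μ) _).2 rfl
      rw [h0] at h
      have hs : s = 0 := (PointwiseNorm.pnorm_eq_zero_iff (μ := μ) _).1 h.symm
      simp [hs]
    · intro v
      obtain ⟨s, hs⟩ := hfst v
      exact ⟨⟨_, hs⟩, rfl⟩
  let e2 : H ≃ₗ[L0 μ] N := LinearEquiv.ofBijective (LinearMap.snd _ M N ∘ₗ H.subtype) <| by
    constructor
    · rw [← LinearMap.ker_eq_bot, LinearMap.ker_eq_bot']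
      rintro ⟨⟨v, s⟩, hp⟩ (rfl : s = 0)
      have h := hHn _ hp
      have h0 : pnorm μ (0 : N) = 0 := (PointwiseNorm.pnorm_eq_zero_iff (μ := μ) _).2 rfl
      rw [h0] at h
      have hv : v = 0 := (PointwiseNorm.pnorm_eq_zero_iff (μ := μ) _).1 h
      simp [hv]
    · intro s
      obtain ⟨v, hv⟩ := hsnd s
      exact ⟨⟨_, hv⟩, rfl⟩
  let e : M ≃ₗ[L0 μ] N := e1.symm.trans e2
  have he : ∀ v, pnorm μ (e v) = pnorm μ v := by
    intro v
    obtain ⟨p, rfl⟩ := e1.surjective v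
    simp only [e, LinearEquiv.trans_apply, LinearEquiv.symm_apply_apply]
    exact (hHn _ p.2).symm
  have he' : ∀ s, pnorm μ (e.symm s) = pnorm μ s := fun s => by
    rw [← he, LinearEquiv.apply_symm_apply]
  let φ : M ⟶ N := (⟨e.toLinearMap, fun v => (he v).le⟩ : Hom M N)
  let ψ : N ⟶ M := (⟨e.symm.toLinearMap, fun s => (he' s).le⟩ : Hom N M)
  refine ⟨⟨φ, ψ, ?_, ?_⟩⟩
  · exact Hom.ext (LinearMap.ext fun v => e.symm_apply_apply v)
  · exact Hom.ext (LinearMap.ext fun s => e.apply_symm_apply s)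

end NormedL0Module

end topology

/-! ### Density of glued sections -/

section glue

variable {X : Type u} [MeasurableSpace X] {μ : Measure X}

/-- The class in `L⁰(μ)` of the indicator function of a measurable set. -/
noncomputable def indL0 (μ : Measure X) (A : {A : Set X // MeasurableSet A}) : L0 μ :=
  AEEqFun.mk (A.1.indicator 1) (measurable_one.indicator A.2).aestronglyMeasurable

theorem coeFn_indL0 (A : {A : Set X // MeasurableSet A}) :
    indL0 μ A =ᵐ[μ] A.1.indicator 1 := AEEqFun.coeFn_mk _ _

theorem dist_indL0_smul_le [SigmaFinite μ] {M : NormedL0Module.{u, w} μ}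
    (A B : {A : Set X // MeasurableSet A}) (v : M) :
    dist (indL0 μ A • v) (indL0 μ B • v) ≤ μ.toFinite.real (symmDiff A.1 B.1) := by
  have hm : MeasurableSet (symmDiff A.1 B.1) := A.2.symmDiff B.2
  rw [NormedL0Module.dist_eq, ← integral_indicator_one hm, ← sub_smul]
  refine integral_mono_ae (integrable_min_pnorm μ _)
    ((integrable_const (1 : ℝ)).indicator hm) ?_
  rw [Filter.EventuallyLE, ae_toFinite_iff]
  filter_upwards [coeFn_pnorm_smul (indL0 μ A - indL0 μ B) v,
    AEEqFun.coeFn_sub (indL0 μ A) (indL0 μ B), coeFn_indL0 (μ := μ) A, coeFn_indL0 (μ := μ) B]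
    with x h1 h2 h3 h4
  rw [h1, h2, Pi.sub_apply, h3, h4]
  by_cases hA : x ∈ A.1 <;> by_cases hB : x ∈ B.1 <;>
    simp [hA, hB, Set.indicator, Set.mem_symmDiff]

variable {𝔹 : Type v} [NormedAddCommGroup 𝔹] [NormedSpace ℝ 𝔹] [SeparableSpace 𝔹]
  [MeasurableSpace 𝔹] [BorelSpace 𝔹] {E : SepBanachBundle μ 𝔹}

theorem coe_sum_apply {ι : Type*} (s : Finset ι) (σ : ι → Sections E) (x : X) :
    ((∑ i ∈ s, σ i : Sections E) : X → 𝔹) x = ∑ i ∈ s, (σ i : X → 𝔹) x := by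
  rw [Submodule.coe_sum, Finset.sum_apply]

/-- A family of sections which is dense in every fiber. -/
def FiberwiseDense {ι : Type*} (σ : ι → Sections E) : Prop :=
  ∀ x, (E.fiber x : Set 𝔹) ⊆ closure (Set.range fun i => (σ i : X → 𝔹) x)

theorem exists_fiberwiseDense [CompleteSpace 𝔹] (E : SepBanachBundle μ 𝔹) :
    ∃ σ : ℕ → Sections E, FiberwiseDense σ := by
  obtain ⟨s, hm, hs, hd⟩ := exists_dense_measurable_selections (fun x => (E.fiber x).isClosed)
    (fun x => ⟨0, (E.fiber x).toSubmodule.zero_mem⟩) E.weaklyMeasurable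
  exact ⟨fun n => ⟨s n, hm n, hs n⟩, hd⟩

variable [CompleteSpace 𝔹] [SigmaFinite μ]

/-- The class of a section, as an element of the normed module `Γ(E)`. -/
def secClass (s : Sections E) : GamModule E := Gam.mk s

theorem secClass_surjective : Function.Surjective (secClass (E := E)) := Gam.mk_surj

theorem secClass_eq_iff {s t : Sections E} :
    secClass s = secClass t ↔ (s : X → 𝔹) =ᵐ[μ] (t : X → 𝔹) := Gam.mk_eq_iff

theorem secClass_sub (s t : Sections E) : secClass (s - t) = secClass s - secClass t := rfl

theorem secClass_sum {ι : Type*} (s : Finset ι) (σ : ι → Sections E) :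
    secClass (∑ i ∈ s, σ i) = ∑ i ∈ s, secClass (σ i) := by
  classical
  induction s using Finset.induction_on with
  | empty => rfl
  | insert i s hi ih =>
    rw [Finset.sum_insert hi, Finset.sum_insert hi, ← ih]
    rfl

theorem smul_secClass (f : L0 μ) (s : Sections E) :
    f • secClass s = secClass (Gam.smulSection f s) := rfl

theorem sum_smul_secClass {ι : Type*} (s : Finset ι) (f : ι → L0 μ) (σ : ι → Sections E) :
    ∑ i ∈ s, f i • secClass (σ i) = secClass (∑ i ∈ s, Gam.smulSection (f i) (σ i)) := by
  simp only [smul_secClass, secClass_sum]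

theorem coeFn_pnorm_secClass (s : Sections E) :
    pnorm μ (secClass s) =ᵐ[μ] fun x => ‖(s : X → 𝔹) x‖ := Gam.coeFn_normSection s

/-- The pointwise norm of a linear combination of classes of sections is computed fiberwise. -/
theorem coeFn_pnorm_sum_smul_secClass {ι : Type*} (s : Finset ι) (f : ι → L0 μ)
    (σ : ι → Sections E) :
    pnorm μ (∑ i ∈ s, f i • secClass (σ i)) =ᵐ[μ]
      fun x => ‖∑ i ∈ s, f i x • (σ i : X → 𝔹) x‖ := by
  rw [sum_smul_secClass]
  filter_upwards [coeFn_pnorm_secClass (∑ i ∈ s, Gam.smulSection (f i) (σ i))] with x hx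
  rw [hx, coe_sum_apply]
  rfl

/-- Every section is approximated by gluing finitely many sections of a fiberwise dense sequence:
on a set of almost full measure one may use the first section of the sequence that is close to the
given one. -/
theorem exists_dist_sum_indL0_lt {σ : ℕ → Sections E} (hσ : FiberwiseDense σ) (s : GamModule E)
    {ε : ℝ} (hε : 0 < ε) :
    ∃ (N : ℕ) (A : ℕ → {A : Set X // MeasurableSet A}),
      dist s (∑ n ∈ Finset.range N, indL0 μ (A n) • secClass (σ n)) < ε := by
  have := UniformSpace.secondCountable_of_separable 𝔹
  obtain ⟨s, rfl⟩ := secClass_surjective s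
  set ν := μ.toFinite with hν
  set δ : ℝ := ε / 2 / (ν.real Set.univ + 1) with hδ
  have hδ0 : 0 < δ := by positivity
  let B : ℕ → Set X := fun n => {x | ‖(s : X → 𝔹) x - (σ n : X → 𝔹) x‖ < δ}
  have hB : ∀ n, MeasurableSet (B n) := fun n =>
    measurableSet_lt (s.2.1.sub (σ n).2.1).norm measurable_const
  have hBu : ⋃ n, B n = Set.univ := by
    refine Set.eq_univ_of_forall fun x => ?_
    obtain ⟨_, ⟨n, rfl⟩, hn⟩ := Metric.mem_closure_iff.1 (hσ x (s.2.2 x)) δ hδ0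
    exact Set.mem_iUnion.2 ⟨n, by rwa [dist_eq_norm] at hn⟩
  -- On `A n`, the `n`-th section is the first one that is `δ`-close to `s`; `C N` is where none of
  -- the first `N` sections is.
  let A : ℕ → {A : Set X // MeasurableSet A} := fun n =>
    ⟨disjointed B n, MeasurableSet.disjointed hB n⟩
  let C : ℕ → Set X := fun N => (⋃ n ∈ Finset.range N, (A n).1)ᶜ
  have hC : ∀ N, MeasurableSet (C N) := fun N =>
    (Finset.measurableSet_biUnion _ fun n _ => (A n).2).compl
  have hClim : Tendsto (fun N => ν (C N)) atTop (𝓝 0) := by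
    have h : Tendsto (fun N => ν (C N)) atTop (𝓝 (ν (⋂ N, C N))) := by
      refine tendsto_measure_iInter_atTop (fun N => (hC N).nullMeasurableSet) ?_
        ⟨0, measure_ne_top _ _⟩
      intro m n hmn
      refine Set.compl_subset_compl.2 (Set.biUnion_subset_biUnion_left ?_)
      exact Finset.coe_subset.2 (Finset.range_mono hmn)
    have h0 : ⋂ N, C N = ∅ := by
      refine Set.eq_empty_of_forall_notMem fun x hx => ?_
      have hx' : x ∈ ⋃ n, disjointed B n := by rw [iUnion_disjointed, hBu]; trivial
      obtain ⟨n, hn⟩ := Set.mem_iUnion.1 hx'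
      exact Set.mem_iInter.1 hx (n + 1)
        (Set.mem_biUnion (Finset.mem_coe.2 (Finset.self_mem_range_succ n)) hn)
    rwa [h0, measure_empty] at h
  obtain ⟨N, hN⟩ := (((ENNReal.tendsto_toReal ENNReal.zero_ne_top).comp hClim).eventually
    (gt_mem_nhds (half_pos hε))).exists
  refine ⟨N, A, ?_⟩
  have hle : dist (secClass s)
      (∑ n ∈ Finset.range N, indL0 μ (A n) • secClass (σ n)) ≤
      ∫ x, (δ + (C N).indicator 1 x) ∂ν := by
    rw [NormedL0Module.dist_eq]
    refine integral_mono_ae (integrable_min_pnorm μ _)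
      ((integrable_const δ).add ((integrable_const (1 : ℝ)).indicator (hC N))) ?_
    rw [Filter.EventuallyLE, ae_toFinite_iff]
    have hcoe := coeFn_pnorm_secClass
      (s - ∑ n ∈ Finset.range N, Gam.smulSection (indL0 μ (A n)) (σ n))
    rw [secClass_sub, ← sum_smul_secClass] at hcoe
    filter_upwards [hcoe, ae_all_iff.2 fun n => coeFn_indL0 (μ := μ) (A n)]
      with x h1 h2
    refine (min_le_min_right 1 (le_of_eq h1)).trans ?_
    by_cases hx : x ∈ C N
    · rw [Set.indicator_of_mem hx, Pi.one_apply]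
      exact (min_le_right _ _).trans (by linarith)
    · rw [Set.indicator_of_notMem hx, add_zero]
      refine (min_le_left _ _).trans ?_
      obtain ⟨n, hn, hxn⟩ : ∃ n ∈ Finset.range N, x ∈ (A n).1 := by
        simpa [C] using hx
      have hval : ((∑ n ∈ Finset.range N, Gam.smulSection (indL0 μ (A n)) (σ n) :
          Sections E) : X → 𝔹) x = (σ n : X → 𝔹) x := by
        rw [coe_sum_apply, Finset.sum_eq_single n]
        · change (indL0 μ (A n)) x • _ = _
          rw [h2, Set.indicator_of_mem hxn, Pi.one_apply, one_smul]
        · intro m _ hmn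
          change (indL0 μ (A m)) x • _ = _
          rw [h2, Set.indicator_of_notMem, zero_smul]
          exact fun hxm => (Set.disjoint_left.1 (disjoint_disjointed B hmn) hxm hxn)
        · exact fun h => absurd hn h
      change ‖(s : X → 𝔹) x - _‖ ≤ δ
      rw [hval]
      exact (disjointed_subset B n hxn).le
  refine hle.trans_lt ?_
  have hi : Integrable ((C N).indicator (1 : X → ℝ)) ν :=
    (integrable_const (1 : ℝ)).indicator (hC N)
  rw [integral_add (integrable_const δ) hi,
    integral_indicator_one (hC N), integral_const, smul_eq_mul]
  have h1 : ν.real Set.univ * δ ≤ ε / 2 := by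
    rw [hδ, mul_div_assoc', div_le_iff₀ (by positivity)]
    nlinarith [measureReal_nonneg (μ := ν) (s := Set.univ)]
  have h2 : ν.real (C N) < ε / 2 := hN
  linarith

/-- The `L⁰(μ)`-span of a fiberwise dense sequence of sections is dense. -/
theorem dense_span_of_fiberwiseDense {σ : ℕ → Sections E} (hσ : FiberwiseDense σ) :
    Dense (Submodule.span (L0 μ) (Set.range fun n => secClass (σ n)) :
      Set (GamModule E)) := by
  refine Metric.dense_iff.2 fun s ε hε => ?_
  obtain ⟨N, A, h⟩ := exists_dist_sum_indL0_lt hσ s hε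
  refine ⟨_, Metric.mem_ball'.2 h, ?_⟩
  exact Submodule.sum_mem _ fun n _ => Submodule.smul_mem _ _ (Submodule.subset_span ⟨n, rfl⟩)

theorem isCountablyGenerated_gamModule (E : SepBanachBundle μ 𝔹) :
    IsCountablyGenerated μ (GamModule E) := by
  obtain ⟨σ, hσ⟩ := exists_fiberwiseDense E
  exact ⟨_, Set.countable_range _, dense_span_of_fiberwiseDense hσ⟩

end glue

/-! ### Separable measure spaces -/

section separable

variable {X : Type u} [MeasurableSpace X] {μ : Measure X}

/-- The `ε`-`δ` form of absolute continuity of finite measures. -/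
theorem exists_pos_measure_lt_of_absolutelyContinuous {ν ρ : Measure X} [IsFiniteMeasure ν]
    [IsFiniteMeasure ρ] (h : ρ ≪ ν) {ε : ENNReal} (hε : ε ≠ 0) :
    ∃ δ > 0, ∀ s, ν s < δ → ρ s < ε := by
  obtain ⟨δ, hδ, H⟩ := exists_pos_setLIntegral_lt_of_measure_lt
    (Measure.lintegral_rnDeriv_lt_top ρ ν).ne hε
  refine ⟨δ, hδ, fun s hs => ?_⟩
  have h1 := H s hs
  rwa [← withDensity_apply', Measure.withDensity_rnDeriv_eq _ _ h] at h1

variable [SigmaFinite μ]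

/-- In a separable measure space some countable family of measurable sets is dense for the finite
measure that defines the distance on `L⁰(μ)`. -/
theorem IsSeparableMeasureSpace.exists_countable_approx (h : IsSeparableMeasureSpace μ) :
    ∃ 𝒜 : Set {A : Set X // MeasurableSet A}, 𝒜.Countable ∧
      ∀ A : {A : Set X // MeasurableSet A}, ∀ ε > 0, ∃ B ∈ 𝒜,
        μ.toFinite.real (symmDiff A.1 B.1) < ε := by
  obtain ⟨ν, hν, h1, -, h2⟩ := h
  obtain ⟨𝒜, hc, hd⟩ := exists_countable_measureDense ν
  refine ⟨Subtype.val ⁻¹' 𝒜, hc.preimage Subtype.val_injective, fun A ε hε => ?_⟩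
  obtain ⟨δ, hδ, H⟩ := exists_pos_measure_lt_of_absolutelyContinuous
    ((toFinite_absolutelyContinuous μ).trans h1) (ENNReal.ofReal_pos.2 hε).ne'
  obtain ⟨r, hr0, hr⟩ : ∃ r : ℝ, 0 < r ∧ ENNReal.ofReal r ≤ δ := by
    rcases eq_or_ne δ ⊤ with rfl | hδt
    · exact ⟨1, one_pos, le_top⟩
    · exact ⟨δ.toReal, ENNReal.toReal_pos hδ.ne' hδt, ENNReal.ofReal_toReal_le⟩
  obtain ⟨B, hB, hAB⟩ := hd.approx A.1 A.2 (measure_ne_top _ _) r hr0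
  refine ⟨⟨B, hd.measurable B hB⟩, hB, ?_⟩
  have h3 := H _ (hAB.trans_le hr)
  rw [Measure.real]
  exact (ENNReal.lt_ofReal_iff_toReal_lt (measure_ne_top _ _)).1 h3

variable {𝔹 : Type v} [NormedAddCommGroup 𝔹] [NormedSpace ℝ 𝔹] [SeparableSpace 𝔹]
  [MeasurableSpace 𝔹] [BorelSpace 𝔹] [CompleteSpace 𝔹]

theorem isSeparableModule_gamModule (h : IsSeparableMeasureSpace μ) (E : SepBanachBundle μ 𝔹) :
    IsSeparableModule μ (GamModule E) := by
  obtain ⟨𝒜, hc, hd⟩ := h.exists_countable_approx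
  obtain ⟨σ, hσ⟩ := exists_fiberwiseDense E
  have : Countable 𝒜 := hc
  let D : (Σ N : ℕ, Fin N → 𝒜) → GamModule E := fun p =>
    ∑ i : Fin p.1, indL0 μ (p.2 i).1 • secClass (σ i)
  refine ⟨Set.range D, Set.countable_range D, Metric.dense_iff.2 fun s ε hε => ?_⟩
  obtain ⟨N, A, hA⟩ := exists_dist_sum_indL0_lt hσ s (half_pos hε)
  choose B hB hAB using fun n => hd (A n) (ε / 2 / (N + 1)) (by positivity)
  refine ⟨D ⟨N, fun i => ⟨B i, hB i⟩⟩, ?_, Set.mem_range_self _⟩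
  have h1 : dist (∑ n ∈ Finset.range N, indL0 μ (A n) • secClass (σ n))
      (D ⟨N, fun i => ⟨B i, hB i⟩⟩) ≤ ε / 2 := by
    rw [Finset.sum_range]
    refine (NormedL0Module.dist_sum_sum_le _ _ _).trans ?_
    refine (Finset.sum_le_sum (g := fun _ => ε / 2 / ((N : ℝ) + 1)) fun i _ => ?_).trans ?_
    · exact (dist_indL0_smul_le (A i) (B i) (secClass (σ i))).trans (hAB i).le
    rw [Finset.sum_const, Finset.card_univ, Fintype.card_fin, nsmul_eq_mul, mul_div_assoc',
      div_le_iff₀ (by positivity)]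
    nlinarith
  rw [Metric.mem_ball, dist_comm]
  linarith [dist_triangle s
    (∑ n ∈ Finset.range N, indL0 μ (A n) • secClass (σ n))
    (D ⟨N, fun i => ⟨B i, hB i⟩⟩)]

end separable

/-! ### Full faithfulness -/

/-- Finitely supported rational sequences are dense in the space of real sequences with the product
topology. -/
theorem denseRange_finsupp_rat : DenseRange fun (q : ℕ →₀ ℚ) (i : ℕ) => (q i : ℝ) := by
  have h : DenseRange (Pi.map fun (_ : ℕ) (q : ℚ) => (q : ℝ)) :=
    DenseRange.piMap fun _ => Rat.denseRange_cast
  rw [DenseRange, ← dense_closure]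
  refine Dense.mono ?_ h
  rintro _ ⟨q, rfl⟩
  refine mem_closure_of_tendsto (b := atTop)
    (f := fun N (i : ℕ) => ((Finsupp.indicator (Finset.range N) fun i _ => q i) i : ℝ)) ?_
    (Eventually.of_forall fun N => Set.mem_range_self _)
  refine tendsto_pi_nhds.2 fun i => tendsto_const_nhds.congr' ?_
  filter_upwards [eventually_gt_atTop i] with N hN
  rw [Finsupp.indicator_of_mem (Finset.mem_range.2 hN)]
  rfl

theorem forall_real_of_forall_rat {C : Set (ℕ → ℝ)} (hC : IsClosed C)
    (h : ∀ q : ℕ →₀ ℚ, (fun i => (q i : ℝ)) ∈ C) (b : ℕ → ℝ) : b ∈ C :=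
  denseRange_finsupp_rat.induction_on b hC h

section extension

variable {𝔹 : Type v} [NormedAddCommGroup 𝔹] [NormedSpace ℝ 𝔹]

theorem norm_map_sub_map_le {V W : ClosedSubmodule ℝ 𝔹} (T : V →ₗ[ℝ] W)
    (hT : ∀ v, ‖(T v : 𝔹)‖ ≤ ‖(v : 𝔹)‖) (v w : V) :
    ‖(T v : 𝔹) - (T w : 𝔹)‖ ≤ ‖(v : 𝔹) - (w : 𝔹)‖ := by
  have h := hT (v + (-1 : ℝ) • w)
  rw [map_add, map_smul] at h
  change ‖(T v : 𝔹) + (-1 : ℝ) • (T w : 𝔹)‖ ≤ ‖(v : 𝔹) + (-1 : ℝ) • (w : 𝔹)‖ at h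
  simpa only [neg_smul, one_smul, ← sub_eq_add_neg] using h

/-- A contraction prescribed on a dense sequence extends to the closed subspace, provided that the
norm inequality holds for rational linear combinations. -/
theorem exists_contraction_extension [CompleteSpace 𝔹] {V W : ClosedSubmodule ℝ 𝔹} {s t : ℕ → 𝔹}
    (hs : ∀ n, s n ∈ V) (hd : (V : Set 𝔹) ⊆ closure (Set.range s)) (ht : ∀ n, t n ∈ W)
    (h : ∀ (S : Finset ℕ) (q : ℕ →₀ ℚ), ‖∑ i ∈ S, (q i : ℝ) • t i‖ ≤ ‖∑ i ∈ S, (q i : ℝ) • s i‖) :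
    ∃ T : V →ₗ[ℝ] W, (∀ v, ‖(T v : 𝔹)‖ ≤ ‖(v : 𝔹)‖) ∧ ∀ n, (T ⟨s n, hs n⟩ : 𝔹) = t n := by
  have hreal : ∀ (S : Finset ℕ) (b : ℕ → ℝ), ‖∑ i ∈ S, b i • t i‖ ≤ ‖∑ i ∈ S, b i • s i‖ :=
    fun S => forall_real_of_forall_rat (C := {b | ‖∑ i ∈ S, b i • t i‖ ≤ ‖∑ i ∈ S, b i • s i‖})
      (isClosed_le (by fun_prop) (by fun_prop)) (h S)
  let s' : ℕ → V.toSubmodule := fun n => ⟨s n, hs n⟩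
  let e : (ℕ →₀ ℝ) →ₗ[ℝ] V.toSubmodule := Finsupp.linearCombination ℝ s'
  let f : (ℕ →₀ ℝ) →ₗ[ℝ] 𝔹 := Finsupp.linearCombination ℝ t
  have hes : ∀ n, e (Finsupp.single n 1) = s' n := fun n => by simp [e]
  have hs' : DenseRange s' := by
    intro v
    rw [Topology.IsInducing.subtypeVal.closure_eq_preimage_closure_image]
    refine closure_mono ?_ (hd v.2)
    rintro _ ⟨n, rfl⟩
    exact ⟨s' n, ⟨n, rfl⟩, rfl⟩
  have he : DenseRange e := by
    refine hs'.mono ?_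
    rintro _ ⟨n, rfl⟩
    exact ⟨_, hes n⟩
  have hef : ∀ a, ‖f a‖ ≤ 1 * ‖e a‖ := by
    intro a
    rw [one_mul]
    have h1 := hreal a.support a
    have h2 : ((e a : V.toSubmodule) : 𝔹) = ∑ i ∈ a.support, a i • s i := by
      simp [e, Finsupp.linearCombination_apply, Finsupp.sum, s']
    change ‖f a‖ ≤ ‖((e a : V.toSubmodule) : 𝔹)‖
    rw [h2]
    exact h1
  let T := f.extendOfNorm e
  have hT : ∀ n, T (s' n) = t n := fun n => by
    rw [← hes, LinearMap.extendOfNorm_eq he ⟨1, hef⟩]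
    simp [f]
  have hTn : ∀ v, ‖T v‖ ≤ ‖v‖ := fun v => by
    simpa using LinearMap.norm_extendOfNorm_apply_le he 1 hef v
  have hTW : ∀ v, T v ∈ W := fun v =>
    hs'.induction_on (p := fun v => T v ∈ W) v (W.isClosed.preimage T.continuous)
      fun n => by rw [hT]; exact ht n
  exact ⟨{ toFun := fun v => ⟨T ⟨v.1, v.2⟩, hTW _⟩
           map_add' := fun v w => Subtype.ext (T.map_add ⟨v.1, v.2⟩ ⟨w.1, w.2⟩)
           map_smul' := fun c v => Subtype.ext (T.map_smul c ⟨v.1, v.2⟩) },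
    fun v => hTn ⟨v.1, v.2⟩, hT⟩

end extension

section fullyFaithful

variable {X : Type u} [MeasurableSpace X] {μ : Measure X}
variable {𝔹 : Type v} [NormedAddCommGroup 𝔹] [NormedSpace ℝ 𝔹] [SeparableSpace 𝔹]
  [MeasurableSpace 𝔹] [BorelSpace 𝔹] {E F : SepBanachBundle μ 𝔹}

/-- A constant, as an element of `L⁰(μ)`. -/
noncomputable def constL0 (μ : Measure X) (c : ℝ) : L0 μ := AEEqFun.const X c

theorem coeFn_constL0 (c : ℝ) : constL0 μ c =ᵐ[μ] fun _ => c := AEEqFun.coeFn_const X c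

/-- A map given on each fiber by a contraction is measurable on the total space as soon as it sends
a fiberwise dense sequence of sections to measurable maps: its value at `(x, v)` is the limit of
its values at the first section of the sequence that is `2⁻ᵏ`-close to `v`. -/
theorem measurable_total_of_fiberwiseDense {σ : ℕ → Sections E} (hσ : FiberwiseDense σ)
    (T : ∀ x, E.fiber x →ₗ[ℝ] F.fiber x) (hT : ∀ x v, ‖(T x v : 𝔹)‖ ≤ ‖(v : 𝔹)‖)
    (hm : ∀ n, Measurable fun x => (T x ⟨(σ n : X → 𝔹) x, (σ n).2.2 x⟩ : 𝔹)) :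
    Measurable (fun p : E.total => (⟨(p.1.1, T p.1.1 ⟨p.1.2, p.2⟩), (T p.1.1 ⟨p.1.2, p.2⟩).2⟩ :
      F.total)) := by
  have := UniformSpace.secondCountable_of_separable 𝔹
  have h1 : Measurable fun p : E.total => p.1.1 := measurable_fst.comp measurable_subtype_coe
  have h2 : Measurable fun p : E.total => p.1.2 := measurable_snd.comp measurable_subtype_coe
  refine Measurable.subtype_mk (h1.prodMk ?_)
  let S : ℕ → ℕ → Set E.total := fun k n => {p | ‖(σ n : X → 𝔹) p.1.1 - p.1.2‖ < (1 / 2) ^ k}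
  have hS : ∀ k n, MeasurableSet (S k n) := fun k n =>
    measurableSet_lt (((σ n).2.1.comp h1).sub h2).norm measurable_const
  let ix : ℕ → E.total → ℕ := fun k p => sInf {n | p ∈ S k n}
  have hix : ∀ k, Measurable (ix k) := fun k =>
    measurable_to_countable' fun n => measurableSet_sInf_eq (hS k) n
  have hmem : ∀ k p, p ∈ S k (ix k p) := by
    intro k p
    obtain ⟨_, ⟨n, rfl⟩, hn⟩ := Metric.mem_closure_iff.1 (hσ p.1.1 p.2) ((1 / 2) ^ k)
      (by positivity)
    refine Nat.sInf_mem (s := {n | p ∈ S k n}) ⟨n, ?_⟩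
    rwa [dist_comm, dist_eq_norm] at hn
  refine measurable_of_tendsto_metrizable (f := fun k (p : E.total) =>
    (T p.1.1 ⟨(σ (ix k p) : X → 𝔹) p.1.1, (σ (ix k p)).2.2 p.1.1⟩ : 𝔹)) (fun k => ?_)
    (tendsto_pi_nhds.2 fun p => ?_)
  · have h3 : Measurable fun np : ℕ × X =>
        (T np.2 ⟨(σ np.1 : X → 𝔹) np.2, (σ np.1).2.2 np.2⟩ : 𝔹) :=
      measurable_from_prod_countable_right hm
    exact h3.comp ((hix k).prodMk h1)
  · rw [tendsto_iff_norm_sub_tendsto_zero]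
    refine squeeze_zero (fun _ => norm_nonneg _) (fun k => ?_)
      (tendsto_pow_atTop_nhds_zero_of_lt_one (r := (1 / 2 : ℝ)) (by norm_num) (by norm_num))
    exact (norm_map_sub_map_le (T p.1.1) (hT p.1.1) _ _).trans (hmem k p).le

variable [CompleteSpace 𝔹] [SigmaFinite μ]

theorem sectionFunctor_map_mk (f : SepBanachBundle.PreHom E F) :
    (sectionFunctor μ 𝔹).map (X := E) (Y := F) (Quotient.mk _ f) = preGamMap f := rfl

theorem preGamMap_secClass (f : SepBanachBundle.PreHom E F) (s : Sections E) :
    (preGamMap f).toLin (secClass s) = secClass (Gam.mapSection f s) := rfl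

instance : (sectionFunctor μ 𝔹).Faithful where
  map_injective {E F} f g h := by
    induction f using Quotient.inductionOn with | _ f
    induction g using Quotient.inductionOn with | _ g
    rw [sectionFunctor_map_mk, sectionFunctor_map_mk] at h
    obtain ⟨σ, hσ⟩ := exists_fiberwiseDense E
    have hn : ∀ n, ∀ᵐ x ∂μ, (Gam.mapSection f (σ n) : X → 𝔹) x =
        (Gam.mapSection g (σ n) : X → 𝔹) x := by
      intro n
      rw [← Filter.EventuallyEq, ← secClass_eq_iff, ← preGamMap_secClass, ← preGamMap_secClass, h]
    have hae : ∀ᵐ x ∂μ, f.toLin x = g.toLin x := by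
      filter_upwards [ae_all_iff.2 hn] with x hx
      refine LinearMap.ext fun v => Subtype.ext ?_
      rw [← sub_eq_zero, ← norm_le_zero_iff]
      refine le_of_forall_pos_lt_add fun ε hε => ?_
      obtain ⟨_, ⟨n, rfl⟩, hv⟩ := Metric.mem_closure_iff.1 (hσ x v.2) (ε / 2) (half_pos hε)
      rw [dist_eq_norm] at hv
      let w : E.fiber x := ⟨(σ n : X → 𝔹) x, (σ n).2.2 x⟩
      have h1 := norm_map_sub_map_le (f.toLin x) (f.contraction x) v w
      have h2 := norm_map_sub_map_le (g.toLin x) (g.contraction x) v w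
      have h3 : (f.toLin x w : 𝔹) = g.toLin x w := hx n
      have h4 := norm_sub_le_norm_sub_add_norm_sub (f.toLin x v : 𝔹) (g.toLin x w : 𝔹)
        (g.toLin x v : 𝔹)
      rw [norm_sub_rev (g.toLin x w : 𝔹)] at h4
      rw [h3] at h1
      have h5 : ‖(v : 𝔹) - (w : 𝔹)‖ < ε / 2 := hv
      linarith
    refine Quotient.sound ⟨toMeasurable μ {x | ¬f.toLin x = g.toLin x},
      measurableSet_toMeasurable _ _, ?_, fun x hx => ?_⟩
    · rw [measure_toMeasurable]
      exact hae
    · by_contra hne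
      exact hx (subset_toMeasurable _ _ hne)

instance : (sectionFunctor μ 𝔹).Full where
  map_surjective {E F} Φ := by
    let Φ' : NormedL0Module.Hom (GamModule E) (GamModule F) := Φ
    obtain ⟨σ, hσ⟩ := exists_fiberwiseDense E
    choose τ hτ using fun n => secClass_surjective (Φ'.toLin (secClass (σ n)))
    -- For rational coefficients the contraction property holds outside a single null set.
    have hle : ∀ᵐ x ∂μ, ∀ (S : Finset ℕ) (q : ℕ →₀ ℚ),
        ‖∑ i ∈ S, (q i : ℝ) • (τ i : X → 𝔹) x‖ ≤ ‖∑ i ∈ S, (q i : ℝ) • (σ i : X → 𝔹) x‖ := by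
      rw [ae_all_iff]
      intro S
      rw [ae_all_iff]
      intro q
      have h := Φ'.pnorm_le (∑ i ∈ S, constL0 μ (q i) • secClass (σ i))
      simp only [map_sum, map_smul, ← hτ] at h
      filter_upwards [AEEqFun.coeFn_le.2 h,
        coeFn_pnorm_sum_smul_secClass S (fun i => constL0 μ (q i)) σ,
        coeFn_pnorm_sum_smul_secClass S (fun i => constL0 μ (q i)) τ,
        ae_all_iff.2 fun i => coeFn_constL0 (μ := μ) (q i)] with x h1 h2 h3 h4
      simpa only [h2, h3, h4] using h1
    set N := toMeasurable μ {x | ¬∀ (S : Finset ℕ) (q : ℕ →₀ ℚ),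
        ‖∑ i ∈ S, (q i : ℝ) • (τ i : X → 𝔹) x‖ ≤ ‖∑ i ∈ S, (q i : ℝ) • (σ i : X → 𝔹) x‖}
      with hN
    have hN0 : μ N = 0 := by
      rw [hN, measure_toMeasurable]
      exact hle
    have hNm : MeasurableSet N := measurableSet_toMeasurable _ _
    have hex : ∀ x, ∃ T : E.fiber x →ₗ[ℝ] F.fiber x, (∀ v, ‖(T v : 𝔹)‖ ≤ ‖(v : 𝔹)‖) ∧
        ∀ n, (T ⟨(σ n : X → 𝔹) x, (σ n).2.2 x⟩ : 𝔹) = Nᶜ.indicator (τ n : X → 𝔹) x := by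
      intro x
      by_cases hx : x ∈ N
      · refine ⟨0, fun v => ?_, fun n => ?_⟩
        · exact norm_zero.trans_le (norm_nonneg _)
        · rw [Set.indicator_of_notMem (by simpa using hx)]
          rfl
      · have hx' : ∀ (S : Finset ℕ) (q : ℕ →₀ ℚ), ‖∑ i ∈ S, (q i : ℝ) • (τ i : X → 𝔹) x‖ ≤
            ‖∑ i ∈ S, (q i : ℝ) • (σ i : X → 𝔹) x‖ := by
          by_contra hne
          exact hx (subset_toMeasurable _ _ hne)
        obtain ⟨T, h1, h2⟩ := exists_contraction_extension (fun n => (σ n).2.2 x) (hσ x)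
          (fun n => (τ n).2.2 x) hx'
        refine ⟨T, h1, fun n => ?_⟩
        rw [h2, Set.indicator_of_mem (by exact hx)]
    choose T hT1 hT2 using hex
    let φ : SepBanachBundle.PreHom E F :=
      { toLin := T
        contraction := hT1
        measurable := measurable_total_of_fiberwiseDense hσ T hT1 fun n => by
          simp only [hT2]
          exact (τ n).2.1.indicator hNm.compl }
    refine ⟨Quotient.mk _ φ, ?_⟩
    rw [sectionFunctor_map_mk]
    refine NormedL0Module.Hom.ext_of_dense_span (f := preGamMap φ) (g := Φ')
      (dense_span_of_fiberwiseDense hσ) ?_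
    rintro _ ⟨n, rfl⟩
    change (preGamMap φ).toLin (secClass (σ n)) = Φ'.toLin (secClass (σ n))
    rw [preGamMap_secClass, ← hτ, secClass_eq_iff]
    filter_upwards [measure_eq_zero_iff_ae_notMem.1 hN0] with x hx
    exact (hT2 x n).trans (Set.indicator_of_mem (by exact hx) _)

end fullyFaithful

/-! ### Retractions of the Cantor set -/

section retraction

/-- The sequence obtained from `t` by flipping the bits in `S`. -/
def flipBits (t : ℕ → Bool) (S : Finset ℕ) (i : ℕ) : Bool := if i ∈ S then !t i else t i

/-- The set `C` contains a sequence with the same first `n` bits as `c`. -/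
def MeetsCylinder (C : Set (ℕ → Bool)) (n : ℕ) (c : ℕ → Bool) : Prop :=
  ∃ c' ∈ C, ∀ i < n, c' i = c i

open Classical in
/-- The positions below `n` at which the greedy retraction onto `C` changes `t`: a bit is kept if
the bits chosen so far, followed by it, still begin some element of `C`. -/
noncomputable def flipSet (C : Set (ℕ → Bool)) (t : ℕ → Bool) : ℕ → Finset ℕ
  | 0 => ∅
  | n + 1 =>
    if MeetsCylinder C (n + 1) (flipBits t (flipSet C t n)) then flipSet C t n
    else insert n (flipSet C t n)

/-- The greedy retraction of the Cantor space onto a closed set `C`. Unlike a retraction defined by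
a choice of points, it depends measurably on `C`. -/
noncomputable def cantorRetract (C : Set (ℕ → Bool)) (t : ℕ → Bool) (n : ℕ) : Bool :=
  flipBits t (flipSet C t (n + 1)) n

variable {C : Set (ℕ → Bool)}

theorem MeetsCylinder.congr {n : ℕ} {c d : ℕ → Bool} (h : ∀ i < n, c i = d i) :
    MeetsCylinder C n c ↔ MeetsCylinder C n d := by
  constructor <;> rintro ⟨e, he, hi⟩ <;> refine ⟨e, he, fun i hin => ?_⟩
  · rw [hi i hin, h i hin]
  · rw [hi i hin, h i hin]

theorem lt_of_mem_flipSet {t : ℕ → Bool} {n i : ℕ} (h : i ∈ flipSet C t n) : i < n := by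
  induction n with
  | zero => simp [flipSet] at h
  | succ n ih =>
    rw [flipSet] at h
    split_ifs at h
    · exact (ih h).trans n.lt_succ_self
    · rcases Finset.mem_insert.1 h with rfl | h
      · exact i.lt_succ_self
      · exact (ih h).trans n.lt_succ_self

theorem mem_flipSet_iff_of_lt {t : ℕ → Bool} {n i : ℕ} (h : i < n) :
    i ∈ flipSet C t n ↔ i ∈ flipSet C t (i + 1) := by
  induction n, h using Nat.le_induction with
  | base => rfl
  | succ n hn ih =>
    rw [← ih]
    conv_lhs => rw [flipSet]
    split_ifs
    · rfl
    · rw [Finset.mem_insert, or_iff_right (by omega)]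

theorem cantorRetract_eq_flipBits {t : ℕ → Bool} {n i : ℕ} (h : i < n) :
    cantorRetract C t i = flipBits t (flipSet C t n) i := by
  simp only [cantorRetract, flipBits, mem_flipSet_iff_of_lt h]

theorem flipSet_congr {t t' : ℕ → Bool} {n : ℕ} (h : ∀ i < n, t i = t' i) :
    flipSet C t n = flipSet C t' n := by
  induction n with
  | zero => rfl
  | succ n ih =>
    have hn := ih fun i hi => h i (hi.trans n.lt_succ_self)
    have hc : MeetsCylinder C (n + 1) (flipBits t (flipSet C t' n)) ↔
        MeetsCylinder C (n + 1) (flipBits t' (flipSet C t' n)) :=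
      MeetsCylinder.congr fun i hi => by simp only [flipBits, h i hi]
    rw [flipSet, flipSet, hn]
    classical
    exact if_congr hc rfl rfl

theorem continuous_cantorRetract (C : Set (ℕ → Bool)) : Continuous (cantorRetract C) := by
  refine continuous_pi fun n => continuous_iff_continuousAt.2 fun t => ?_
  have h : ∀ᶠ t' in 𝓝 t, ∀ i ∈ Finset.range (n + 1), t' i = t i := by
    rw [Filter.eventually_all_finset]
    intro i _
    exact (continuous_apply i).continuousAt.eventually (Filter.mem_of_superset
      ((isOpen_discrete {t i}).mem_nhds rfl) fun b hb => hb)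
  refine tendsto_const_nhds.congr' ?_
  filter_upwards [h] with t' ht'
  have h' : ∀ i < n + 1, t i = t' i := fun i hi => (ht' i (Finset.mem_range.2 hi)).symm
  simp only [cantorRetract, flipBits, flipSet_congr h', h' n n.lt_succ_self]

theorem meetsCylinder_flipBits (hne : C.Nonempty) (t : ℕ → Bool) (n : ℕ) :
    MeetsCylinder C n (flipBits t (flipSet C t n)) := by
  induction n with
  | zero => exact ⟨hne.some, hne.some_mem, fun i hi => absurd hi i.not_lt_zero⟩
  | succ n ih =>
    rw [flipSet]
    split_ifs with h
    · exact h
    · obtain ⟨c, hc, hi⟩ := ih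
      have hn : n ∉ flipSet C t n := fun hmem => lt_irrefl _ (lt_of_mem_flipSet hmem)
      refine ⟨c, hc, fun i hin => ?_⟩
      rcases Nat.lt_succ_iff_lt_or_eq.1 hin with hlt | rfl
      · rw [hi i hlt]
        simp [flipBits, hlt.ne]
      · have hci : c i ≠ t i := by
          intro hci
          refine h ⟨c, hc, fun j hj => ?_⟩
          rcases Nat.lt_succ_iff_lt_or_eq.1 hj with hlt | rfl
          · exact hi j hlt
          · rw [hci, flipBits, if_neg hn]
        rw [flipBits, if_pos (Finset.mem_insert_self _ _)]
        exact Bool.eq_not.2 hci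

theorem cantorRetract_mem (hc : IsClosed C) (hne : C.Nonempty) (t : ℕ → Bool) :
    cantorRetract C t ∈ C := by
  choose c hcC hc' using meetsCylinder_flipBits hne t
  refine hc.mem_of_tendsto (b := atTop) (f := c) (tendsto_pi_nhds.2 fun i => ?_)
    (Eventually.of_forall hcC)
  refine tendsto_const_nhds.congr' ?_
  filter_upwards [eventually_gt_atTop i] with n hn
  rw [hc' n i hn, cantorRetract_eq_flipBits hn]

theorem cantorRetract_of_mem {t : ℕ → Bool} (ht : t ∈ C) : cantorRetract C t = t := by
  have h : ∀ n, flipSet C t n = ∅ := by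
    intro n
    induction n with
    | zero => rfl
    | succ n ih =>
      rw [flipSet, ih, if_pos]
      exact ⟨t, ht, fun i _ => by simp [flipBits]⟩
  funext n
  simp [cantorRetract, h, flipBits]

theorem measurable_cantorRetract {P : Type*} [MeasurableSpace P] {C : P → Set (ℕ → Bool)}
    (hC : ∀ n c, MeasurableSet {p | MeetsCylinder (C p) n c}) (t : ℕ → Bool) :
    Measurable fun p => cantorRetract (C p) t := by
  classical
  have hF : ∀ n S, MeasurableSet {p | flipSet (C p) t n = S} := by
    refine measurableSet_iterate_eq (fun n p => flipSet (C p) t n)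
      (fun n p S => if MeetsCylinder (C p) (n + 1) (flipBits t S) then S else insert n S)
      (fun S => MeasurableSet.const (∅ = S)) (fun n S S' => ?_) fun n p => ?_
    · have : {p | (if MeetsCylinder (C p) (n + 1) (flipBits t S) then S else insert n S) = S'} =
          ({p | MeetsCylinder (C p) (n + 1) (flipBits t S)} ∩ {_p | S = S'}) ∪
          ({p | MeetsCylinder (C p) (n + 1) (flipBits t S)}ᶜ ∩ {_p | insert n S = S'}) := by
        ext p
        by_cases h : MeetsCylinder (C p) (n + 1) (flipBits t S) <;> simp [h]
      rw [this]
      exact ((hC _ _).inter (MeasurableSet.const _)).union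
        ((hC _ _).compl.inter (MeasurableSet.const _))
    · simp only [flipSet]
  refine measurable_pi_lambda _ fun n => measurable_to_countable' fun b => ?_
  have : (fun p => cantorRetract (C p) t n) ⁻¹' {b} =
      ⋃ S : Finset ℕ, {p | flipSet (C p) t (n + 1) = S} ∩ {_p | flipBits t S n = b} := by
    ext p
    simp [cantorRetract]
  rw [this]
  exact MeasurableSet.iUnion fun S => (hF _ S).inter (MeasurableSet.const _)

end retraction

/-! ### Seminorms on finitely supported rational sequences -/

section seminorm

/-- A seminorm on the rational vector space of finitely supported rational sequences, normalized so
that the unit vectors have norm at most one. -/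
structure IsRatSeminorm (p : (ℕ →₀ ℚ) → ℝ) : Prop where
  add_le : ∀ q r, p (q + r) ≤ p q + p r
  smul : ∀ (c : ℚ) q, p (c • q) = |(c : ℝ)| * p q
  single_le : ∀ i, p (Finsupp.single i 1) ≤ 1

/-- The inclusion of rational into real finitely supported sequences. -/
noncomputable def ratToReal (q : ℕ →₀ ℚ) : ℕ →₀ ℝ := q.mapRange (fun c : ℚ => (c : ℝ)) Rat.cast_zero

theorem ratToReal_apply (q : ℕ →₀ ℚ) (i : ℕ) : ratToReal q i = q i := Finsupp.mapRange_apply ..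

theorem ratToReal_zero : ratToReal 0 = 0 := by
  ext i
  simp [ratToReal_apply]

theorem ratToReal_add (q r : ℕ →₀ ℚ) : ratToReal (q + r) = ratToReal q + ratToReal r := by
  ext i
  simp [ratToReal_apply]

theorem ratToReal_sub (q r : ℕ →₀ ℚ) : ratToReal (q - r) = ratToReal q - ratToReal r := by
  ext i
  simp [ratToReal_apply]

theorem ratToReal_smul (c : ℚ) (q : ℕ →₀ ℚ) : ratToReal (c • q) = (c : ℝ) • ratToReal q := by
  ext i
  simp [ratToReal_apply]

/-- The `ℓ¹`-norm of a finitely supported sequence. -/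
noncomputable def ellOne (a : ℕ →₀ ℝ) : ℝ := a.sum fun _ c => |c|

theorem ellOne_eq {a : ℕ →₀ ℝ} {S : Finset ℕ} (h : a.support ⊆ S) : ellOne a = ∑ i ∈ S, |a i| :=
  Finsupp.sum_of_support_subset a h _ fun _ _ => abs_zero

theorem ellOne_nonneg (a : ℕ →₀ ℝ) : 0 ≤ ellOne a := Finset.sum_nonneg fun _ _ => abs_nonneg _

theorem ellOne_add_le (a b : ℕ →₀ ℝ) : ellOne (a + b) ≤ ellOne a + ellOne b := by
  classical
  rw [ellOne_eq (a := a) (Finset.subset_union_left (s₂ := b.support)),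
    ellOne_eq (a := b) (Finset.subset_union_right (s₁ := a.support)),
    ellOne_eq (a := a + b) Finsupp.support_add, ← Finset.sum_add_distrib]
  exact Finset.sum_le_sum fun i _ => abs_add_le _ _

theorem ellOne_smul (c : ℝ) (a : ℕ →₀ ℝ) : ellOne (c • a) = |c| * ellOne a := by
  rw [ellOne_eq Finsupp.support_smul, ellOne_eq subset_rfl, Finset.mul_sum]
  exact Finset.sum_congr rfl fun i _ => abs_mul _ _

namespace IsRatSeminorm

variable {p : (ℕ →₀ ℚ) → ℝ} (hp : IsRatSeminorm p)
include hp

theorem map_zero : p 0 = 0 := by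
  have h := hp.smul 0 0
  simpa using h

theorem map_neg (q : ℕ →₀ ℚ) : p (-q) = p q := by
  have h := hp.smul (-1) q
  simpa using h

theorem nonneg (q : ℕ →₀ ℚ) : 0 ≤ p q := by
  have h := hp.add_le q (-q)
  rw [add_neg_cancel, hp.map_zero, hp.map_neg] at h
  linarith

theorem le_ellOne (q : ℕ →₀ ℚ) : p q ≤ ellOne (ratToReal q) := by
  have h : p (∑ i ∈ q.support, Finsupp.single i (q i)) ≤
      ∑ i ∈ q.support, p (Finsupp.single i (q i)) :=
    Finset.le_sum_of_subadditive p hp.map_zero.le hp.add_le _ _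
  have hq : ∑ i ∈ q.support, Finsupp.single i (q i) = q := Finsupp.sum_single q
  rw [hq] at h
  refine h.trans ?_
  rw [ellOne_eq (a := ratToReal q) (S := q.support) (Finsupp.support_mapRange)]
  refine Finset.sum_le_sum fun i _ => ?_
  have h1 := hp.smul (q i) (Finsupp.single i 1)
  rw [Finsupp.smul_single, smul_eq_mul, mul_one] at h1
  rw [h1, ratToReal_apply]
  exact mul_le_of_le_one_right (abs_nonneg _) (hp.single_le i)

end IsRatSeminorm

/-- The extension of a rational seminorm to real sequences, as the infimal convolution with the
`ℓ¹`-norm. It agrees with `p` on rational sequences because `p` is bounded by the `ℓ¹`-norm there,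
and it is homogeneous for real scalars by continuity. -/
noncomputable def realExt (p : (ℕ →₀ ℚ) → ℝ) (a : ℕ →₀ ℝ) : ℝ :=
  ⨅ r : ℕ →₀ ℚ, (p r + ellOne (a - ratToReal r))

namespace IsRatSeminorm

variable {p : (ℕ →₀ ℚ) → ℝ} (hp : IsRatSeminorm p)
include hp

theorem realExt_le (a : ℕ →₀ ℝ) (r : ℕ →₀ ℚ) : realExt p a ≤ p r + ellOne (a - ratToReal r) :=
  ciInf_le ⟨0, by
    rintro _ ⟨r, rfl⟩
    exact add_nonneg (hp.nonneg r) (ellOne_nonneg _)⟩ r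

theorem realExt_nonneg (a : ℕ →₀ ℝ) : 0 ≤ realExt p a :=
  le_ciInf fun r => add_nonneg (hp.nonneg r) (ellOne_nonneg _)

theorem realExt_ratToReal (q : ℕ →₀ ℚ) : realExt p (ratToReal q) = p q := by
  refine le_antisymm ?_ (le_ciInf fun r => ?_)
  · have h := hp.realExt_le (ratToReal q) q
    rw [sub_self] at h
    simpa [ellOne] using h
  · have h1 := hp.add_le r (q - r)
    rw [add_sub_cancel] at h1
    rw [← ratToReal_sub]
    linarith [hp.le_ellOne (q - r)]

theorem realExt_add_le (a b : ℕ →₀ ℝ) : realExt p (a + b) ≤ realExt p a + realExt p b := by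
  refine le_ciInf_add_ciInf fun r s => (hp.realExt_le (a + b) (r + s)).trans ?_
  have h := ellOne_add_le (a - ratToReal r) (b - ratToReal s)
  rw [sub_add_sub_comm, ← ratToReal_add] at h
  linarith [hp.add_le r s]

theorem realExt_le_add_ellOne (a b : ℕ →₀ ℝ) : realExt p a ≤ realExt p b + ellOne (a - b) := by
  rw [← sub_le_iff_le_add]
  refine le_ciInf fun r => ?_
  have h := ellOne_add_le (a - b) (b - ratToReal r)
  rw [sub_add_sub_cancel] at h
  linarith [hp.realExt_le a r]

theorem realExt_rat_smul_le {c : ℚ} (hc : 0 < c) (a : ℕ →₀ ℝ) :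
    realExt p ((c : ℝ) • a) ≤ c * realExt p a := by
  have hc' : (0 : ℝ) < c := Rat.cast_pos.2 hc
  rw [← div_le_iff₀' hc']
  refine le_ciInf fun r => ?_
  rw [div_le_iff₀' hc']
  have h := hp.realExt_le ((c : ℝ) • a) (c • r)
  rwa [ratToReal_smul, ← smul_sub, ellOne_smul, hp.smul, abs_of_pos hc', ← mul_add] at h

theorem realExt_rat_smul {c : ℚ} (hc : 0 < c) (a : ℕ →₀ ℝ) :
    realExt p ((c : ℝ) • a) = c * realExt p a := by
  have hc' : (0 : ℝ) < c := Rat.cast_pos.2 hc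
  refine le_antisymm (hp.realExt_rat_smul_le hc a) ?_
  have h := hp.realExt_rat_smul_le (inv_pos.2 hc) ((c : ℝ) • a)
  rw [smul_smul, Rat.cast_inv, inv_mul_cancel₀ hc'.ne', one_smul] at h
  rwa [← le_inv_mul_iff₀ hc']

theorem realExt_smul {c : ℝ} (hc : 0 < c) (a : ℕ →₀ ℝ) :
    realExt p (c • a) = c * realExt p a := by
  have hcont : Continuous fun c : ℝ => realExt p (|c| • a) := by
    refine (LipschitzWith.of_le_add_mul (ellOne a).toNNReal fun c d => ?_).continuous
    refine (hp.realExt_le_add_ellOne (|c| • a) (|d| • a)).trans ?_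
    rw [← sub_smul, ellOne_smul, Real.coe_toNNReal _ (ellOne_nonneg a), mul_comm, Real.dist_eq]
    gcongr _ + _ * ?_
    · exact ellOne_nonneg a
    · exact abs_abs_sub_abs_le_abs_sub c d
  have h : realExt p (|c| • a) = |c| * realExt p a := by
    refine Rat.denseRange_cast.induction_on (p := fun c : ℝ =>
      realExt p (|c| • a) = |c| * realExt p a) c
      (isClosed_eq hcont (continuous_abs.mul continuous_const)) fun q => ?_
    rcases eq_or_ne q 0 with rfl | hq
    · have h0 := hp.realExt_ratToReal 0
      rw [ratToReal_zero, hp.map_zero] at h0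
      simpa using h0
    · have := hp.realExt_rat_smul (abs_pos.2 hq) a
      rwa [Rat.cast_abs] at this
  rwa [abs_of_pos hc] at h

end IsRatSeminorm

/-- The real number `∑ qᵢ fᵢ`. -/
noncomputable def ratPairing (f : ℕ → ℝ) (q : ℕ →₀ ℚ) : ℝ := ∑ i ∈ q.support, (q i : ℝ) * f i

/-- The Hilbert cube, in which the dual unit balls of all normalized seminorms live. -/
abbrev Cube : Type := ℕ → Set.Icc (-1 : ℝ) 1

/-- The unit ball of the dual of `p`; a functional is recorded by its values on the unit vectors. -/
def dualBall (p : (ℕ →₀ ℚ) → ℝ) : Set Cube := {f | ∀ q, |ratPairing (fun i => f i) q| ≤ p q}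

/-- The Hahn–Banach theorem for rational seminorms. -/
theorem IsRatSeminorm.exists_mem_dualBall {p : (ℕ →₀ ℚ) → ℝ} (hp : IsRatSeminorm p)
    (q : ℕ →₀ ℚ) : ∃ f ∈ dualBall p, ratPairing (fun i => f i) q = p q := by
  obtain ⟨F, hFq, hF⟩ : ∃ F : (ℕ →₀ ℝ) →ₗ[ℝ] ℝ,
      F (ratToReal q) = p q ∧ ∀ a, F a ≤ realExt p a := by
    rcases eq_or_ne (ratToReal q) 0 with hq | hq
    · refine ⟨0, ?_, fun a => hp.realExt_nonneg a⟩
      have h1 := hp.realExt_ratToReal q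
      have h2 := hp.realExt_ratToReal 0
      rw [hq, ← ratToReal_zero, h2, hp.map_zero] at h1
      simpa using h1
    · obtain ⟨F, h1, h2⟩ := exists_extension_of_le_sublinear
        (LinearPMap.mkSpanSingleton (ratToReal q) (p q) hq) (realExt p)
        (fun c hc a => hp.realExt_smul hc a) hp.realExt_add_le (by
          rintro ⟨a, ha⟩
          obtain ⟨c, rfl⟩ := Submodule.mem_span_singleton.1 ha
          rw [LinearPMap.mkSpanSingleton'_apply, smul_eq_mul]
          rcases le_or_gt c 0 with hc | hc
          · exact (mul_nonpos_of_nonpos_of_nonneg hc (hp.nonneg q)).trans (hp.realExt_nonneg _)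
          · rw [← hp.realExt_ratToReal q]
            exact (hp.realExt_smul hc _).ge)
      refine ⟨F, ?_, h2⟩
      have h3 := h1 ⟨ratToReal q, Submodule.mem_span_singleton_self _⟩
      exact h3.trans (LinearPMap.mkSpanSingleton_apply ℝ ℝ hq (p q))
  have hFr : ∀ r, |F (ratToReal r)| ≤ p r := by
    intro r
    rw [abs_le]
    constructor
    · have h := hF (ratToReal (-r))
      have hneg : ratToReal (-r) = -ratToReal r := by
        ext i
        simp [ratToReal_apply]
      rw [hp.realExt_ratToReal, hp.map_neg, hneg, F.map_neg] at h
      linarith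
    · exact (hF _).trans_eq (hp.realExt_ratToReal r)
  have hone : ∀ i, ratToReal (Finsupp.single i 1) = Finsupp.single i 1 := fun i => by
    rw [ratToReal, Finsupp.mapRange_single, Rat.cast_one]
  have hpair : ∀ r, ratPairing (fun i => F (Finsupp.single i 1)) r = F (ratToReal r) := by
    intro r
    have h : ratToReal r = ∑ i ∈ r.support, (r i : ℝ) • Finsupp.single i (1 : ℝ) := by
      ext j
      rw [ratToReal_apply, Finsupp.finsetSum_apply]
      simp [Finsupp.single_apply]
    rw [h, map_sum]
    simp only [ratPairing, map_smul, smul_eq_mul]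
  refine ⟨fun i => ⟨F (Finsupp.single i 1), abs_le.1 ?_⟩, fun r => ?_, ?_⟩
  · rw [← hone]
    exact (hFr _).trans (hp.single_le i)
  · change |ratPairing (fun i => F (Finsupp.single i 1)) r| ≤ p r
    rw [hpair]
    exact hFr r
  · exact (hpair q).trans hFq

end seminorm

/-! ### A measurable family of embeddings into the continuous functions on the Cantor set -/

section model

theorem exists_cantor_cube : ∃ π : (ℕ → Bool) → Cube, Continuous π ∧ Function.Surjective π := by
  have : Nonempty Cube := ⟨fun _ => ⟨0, by norm_num⟩⟩
  let _ : MetricSpace Cube := metrizableSpaceMetric Cube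
  exact exists_nat_bool_continuous_surjective_of_compact Cube

/-- Whether a compact piece of the Cantor set meets the preimage of the dual ball of `p` is a closed
condition on `p`, since a projection along a compact space is a closed map. -/
theorem isClosed_meetsCylinder_dualBall {π : (ℕ → Bool) → Cube} (hπ : Continuous π) (n : ℕ)
    (c : ℕ → Bool) : IsClosed {p | MeetsCylinder (π ⁻¹' dualBall p) n c} := by
  have h : {p | MeetsCylinder (π ⁻¹' dualBall p) n c} =
      Prod.snd '' ((⋂ i, {x : (ℕ → Bool) × ((ℕ →₀ ℚ) → ℝ) | i < n → x.1 i = c i}) ∩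
        ⋂ q, {x | |ratPairing (fun i => π x.1 i) q| ≤ x.2 q}) := by
    ext p
    constructor
    · rintro ⟨c', h1, h2⟩
      exact ⟨(c', p), ⟨Set.mem_iInter.2 h2, Set.mem_iInter.2 h1⟩, rfl⟩
    · rintro ⟨⟨c', p⟩, ⟨h2, h1⟩, rfl⟩
      exact ⟨c', Set.mem_iInter.1 h1, Set.mem_iInter.1 h2⟩
  rw [h]
  refine isClosedMap_snd_of_compactSpace _ ((isClosed_iInter fun i => ?_).inter
    (isClosed_iInter fun q => ?_))
  · exact isClosed_imp isOpen_const
      (isClosed_eq ((continuous_apply i).comp continuous_fst) continuous_const)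
  · refine isClosed_le (continuous_abs.comp ?_) ((continuous_apply q).comp continuous_snd)
    refine continuous_finsetSum _ fun i _ => continuous_const.mul ?_
    exact continuous_subtype_val.comp ((continuous_apply i).comp (hπ.comp continuous_fst))

/-- All normalized rational seminorms are realized, measurably, by sequences of continuous functions
on the Cantor set. This is the Banach–Mazur embedding: a vector is viewed as a function on the dual
unit ball, which is parametrized by the Cantor set through the greedy retraction. -/
theorem exists_cantor_model : ∃ g : ℕ → ((ℕ →₀ ℚ) → ℝ) → C(ℕ → Bool, ℝ),
    (∀ n t, Measurable fun p => g n p t) ∧ ∀ p, IsRatSeminorm p →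
      ∀ q : ℕ →₀ ℚ, ‖∑ i ∈ q.support, (q i : ℝ) • g i p‖ = p q := by
  obtain ⟨π, hπ, hsurj⟩ := exists_cantor_cube
  let r : ((ℕ →₀ ℚ) → ℝ) → (ℕ → Bool) → (ℕ → Bool) := fun p => cantorRetract (π ⁻¹' dualBall p)
  have hr : ∀ p, Continuous (r p) := fun p => continuous_cantorRetract _
  have hev : ∀ n, Continuous fun c => (π c n : ℝ) := fun n =>
    continuous_subtype_val.comp ((continuous_apply n).comp hπ)
  let g : ℕ → ((ℕ →₀ ℚ) → ℝ) → C(ℕ → Bool, ℝ) := fun n p =>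
    ⟨fun t => (π (r p t) n : ℝ), (hev n).comp (hr p)⟩
  refine ⟨g, fun n t => ?_, fun p hp q => ?_⟩
  · exact (hev n).measurable.comp (measurable_cantorRetract
      (fun n c => (isClosed_meetsCylinder_dualBall hπ n c).measurableSet) t)
  · have hval : ∀ t, (∑ i ∈ q.support, (q i : ℝ) • g i p) t =
        ratPairing (fun i => π (r p t) i) q := by
      intro t
      rw [ContinuousMap.sum_apply]
      rfl
    have hclosed : IsClosed (π ⁻¹' dualBall p) := by
      refine IsClosed.preimage hπ ?_
      simp only [dualBall, Set.ofPred_forall]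
      refine isClosed_iInter fun q => isClosed_le (continuous_abs.comp ?_) continuous_const
      exact continuous_finsetSum _ fun i _ => continuous_const.mul
        (continuous_subtype_val.comp (continuous_apply i))
    obtain ⟨f, hf, hfq⟩ := hp.exists_mem_dualBall q
    obtain ⟨t, rfl⟩ := hsurj f
    refine le_antisymm ?_ ?_
    · rw [ContinuousMap.norm_le _ (hp.nonneg q)]
      intro t'
      rw [hval, Real.norm_eq_abs]
      exact cantorRetract_mem hclosed ⟨t, hf⟩ t' q
    · have h := ContinuousMap.norm_coe_le_norm (∑ i ∈ q.support, (q i : ℝ) • g i p) t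
      rw [hval, show r p t = t from cantorRetract_of_mem hf, hfq] at h
      exact (le_abs_self _).trans h

/-- A map into the continuous functions on a compact space is measurable if its point evaluations
are. -/
theorem measurable_of_forall_eval {P K : Type*} [MeasurableSpace P] [TopologicalSpace K]
    [CompactSpace K] [SeparableSpace K] [SeparableSpace C(K, ℝ)] [MeasurableSpace C(K, ℝ)]
    [BorelSpace C(K, ℝ)] {g : P → C(K, ℝ)} (hg : ∀ t, Measurable fun p => g p t) :
    Measurable g := by
  obtain ⟨D, hDc, hDd⟩ := TopologicalSpace.exists_countable_dense K
  have hball : ∀ (f : C(K, ℝ)) (ε : ℝ), 0 ≤ ε → MeasurableSet (g ⁻¹' Metric.closedBall f ε) := by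
    intro f ε hε
    have : g ⁻¹' Metric.closedBall f ε = ⋂ t ∈ D, {p | |g p t - f t| ≤ ε} := by
      ext p
      simp only [Set.mem_preimage, Metric.mem_closedBall, Set.mem_iInter, Set.mem_ofPred_eq]
      rw [ContinuousMap.dist_le hε]
      refine ⟨fun h t _ => h t, fun h t => ?_⟩
      refine hDd.induction (P := fun t => dist (g p t) (f t) ≤ ε) h ?_ t
      exact isClosed_le (by fun_prop) continuous_const
    rw [this]
    exact MeasurableSet.biInter hDc fun t _ =>
      measurableSet_le ((hg t).sub measurable_const).abs measurable_const
  refine measurable_of_isOpen fun U hU => ?_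
  have : U = ⋃ x : {x : ℕ × ℕ | Metric.closedBall (denseSeq C(K, ℝ) x.1) (1 / (x.2 + 1)) ⊆ U},
      Metric.closedBall (denseSeq C(K, ℝ) x.1.1) (1 / (x.1.2 + 1)) := by
    refine Set.Subset.antisymm (fun f hf => ?_) (Set.iUnion_subset fun x => x.2)
    obtain ⟨ε, hε, hfU⟩ := Metric.isOpen_iff.1 hU f hf
    obtain ⟨m, hm⟩ := exists_nat_one_div_lt (half_pos hε)
    obtain ⟨n, hn⟩ := (denseRange_denseSeq C(K, ℝ)).exists_dist_lt f
      (show (0 : ℝ) < 1 / (m + 1) by positivity)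
    refine Set.mem_iUnion.2 ⟨⟨(n, m), fun h hh => hfU ?_⟩, hn.le⟩
    rw [Metric.mem_closedBall] at hh
    rw [Metric.mem_ball]
    rw [dist_comm] at hn
    linarith [dist_triangle h (denseSeq C(K, ℝ) n) f]
  rw [this, Set.preimage_iUnion]
  exact MeasurableSet.iUnion fun x => hball _ _ (by positivity)

end model

/-! ### Essential surjectivity -/

section universal

variable {𝔹 : Type v} [NormedAddCommGroup 𝔹] [NormedSpace ℝ 𝔹]

theorem IsUniversal.exists_embedding (h : IsUniversal.{v, w} 𝔹) :
    Nonempty (C(ℕ → Bool, ℝ) →ₗᵢ[ℝ] 𝔹) := by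
  have : SeparableSpace (ULift.{w} C(ℕ → Bool, ℝ)) :=
    Homeomorph.ulift.symm.surjective.denseRange.separableSpace Homeomorph.ulift.symm.continuous
  have : CompleteSpace (ULift.{w} C(ℕ → Bool, ℝ)) := inferInstance
  obtain ⟨J⟩ := h (ULift.{w} C(ℕ → Bool, ℝ))
  exact ⟨J.comp (LinearIsometryEquiv.ulift ℝ _).symm.toLinearIsometry⟩

end universal

section spanBundle

variable {X : Type u} [MeasurableSpace X]
variable {𝔹 : Type v} [NormedAddCommGroup 𝔹] [NormedSpace ℝ 𝔹]

/-- Rational linear combinations are dense in the closed real span of a sequence. -/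
theorem closure_span_subset_closure_range_rat (z : ℕ → 𝔹) :
    closure (Submodule.span ℝ (Set.range z) : Set 𝔹) ⊆
      closure (Set.range fun q : ℕ →₀ ℚ => ∑ i ∈ q.support, (q i : ℝ) • z i) := by
  classical
  refine closure_minimal (fun y hy => ?_) isClosed_closure
  obtain ⟨a, rfl⟩ := Finsupp.mem_span_range_iff_exists_finsupp.1 hy
  refine forall_real_of_forall_rat (C := {b | ∑ i ∈ a.support, b i • z i ∈
    closure (Set.range fun q : ℕ →₀ ℚ => ∑ i ∈ q.support, (q i : ℝ) • z i)})
    (isClosed_closure.preimage (by fun_prop))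
    (fun q => subset_closure ⟨q.filter (· ∈ a.support), ?_⟩) a
  have h := Finsupp.sum_of_support_subset (q.filter (· ∈ a.support)) (s := a.support)
    (by simp [Finsupp.support_filter, Finset.subset_iff]) (fun i c => (c : ℝ) • z i) (by simp)
  refine h.trans (Finset.sum_congr rfl fun i hi => ?_)
  rw [Finsupp.filter_apply_pos _ _ hi]

variable [SeparableSpace 𝔹] [MeasurableSpace 𝔹] [BorelSpace 𝔹]

theorem measurable_sum_rat_smul {γ : ℕ → X → 𝔹} (hγ : ∀ n, Measurable (γ n)) (q : ℕ →₀ ℚ) :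
    Measurable fun x => ∑ i ∈ q.support, (q i : ℝ) • γ i x := by
  have := UniformSpace.secondCountable_of_separable 𝔹
  exact Finset.measurable_fun_sum _ fun i _ => (hγ i).const_smul _

/-- The bundle whose fiber at `x` is the closed linear span of the values at `x` of a sequence of
measurable maps. -/
def spanBundle (μ : Measure X) (γ : ℕ → X → 𝔹) (hγ : ∀ n, Measurable (γ n)) :
    SepBanachBundle μ 𝔹 where
  fiber x := ⟨(Submodule.span ℝ (Set.range fun n => γ n x)).topologicalClosure,
    Submodule.isClosed_topologicalClosure _⟩
  weaklyMeasurable U hU := by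
    have : {x | ((Submodule.span ℝ (Set.range fun n => γ n x)).topologicalClosure ∩
        U : Set 𝔹).Nonempty} =
        ⋃ q : ℕ →₀ ℚ, (fun x => ∑ i ∈ q.support, (q i : ℝ) • γ i x) ⁻¹' U := by
      ext x
      rw [Set.mem_iUnion]
      constructor
      · rintro ⟨y, hy, hyU⟩
        obtain ⟨_, hzU, q, rfl⟩ := mem_closure_iff.1
          (closure_span_subset_closure_range_rat _ hy) U hU hyU
        exact ⟨q, hzU⟩
      · rintro ⟨q, hq⟩
        refine ⟨_, subset_closure ?_, hq⟩
        exact Submodule.sum_mem _ fun i _ => Submodule.smul_mem _ _ (Submodule.subset_span ⟨i, rfl⟩)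
    exact this ▸ MeasurableSet.iUnion fun q => measurable_sum_rat_smul hγ q hU.measurableSet

variable {μ : Measure X} {γ : ℕ → X → 𝔹} (hγ : ∀ n, Measurable (γ n))

/-- The sections that span the fibers of `spanBundle`. -/
def spanSection (n : ℕ) : Sections (spanBundle μ γ hγ) :=
  ⟨γ n, hγ n, fun _ => subset_closure (Submodule.subset_span ⟨n, rfl⟩)⟩

variable [CompleteSpace 𝔹] [SigmaFinite μ]

theorem dense_span_spanSection :
    Dense (Submodule.span (L0 μ) (Set.range fun n => secClass (spanSection (μ := μ) hγ n)) :
      Set (GamModule (spanBundle μ γ hγ))) := by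
  obtain ⟨e, he⟩ := exists_surjective_nat (ℕ →₀ ℚ)
  let σ : (ℕ →₀ ℚ) → Sections (spanBundle μ γ hγ) := fun q =>
    ∑ i ∈ q.support, (q i : ℝ) • spanSection hγ i
  have hσ : ∀ q x, (σ q : X → 𝔹) x = ∑ i ∈ q.support, (q i : ℝ) • γ i x := fun q x => by
    rw [coe_sum_apply]
    rfl
  have hd : FiberwiseDense fun n => σ (e n) := by
    intro x y hy
    have h : (Set.range fun n => (σ (e n) : X → 𝔹) x) =
        Set.range fun q : ℕ →₀ ℚ => ∑ i ∈ q.support, (q i : ℝ) • γ i x := by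
      rw [← he.range_comp]
      simp only [hσ]
      rfl
    rw [h]
    exact closure_span_subset_closure_range_rat _ hy
  refine (dense_span_of_fiberwiseDense hd).mono (Submodule.span_le.2 ?_)
  rintro _ ⟨n, rfl⟩
  have h : secClass (σ (e n)) =
      ∑ i ∈ (e n).support, constL0 μ (e n i) • secClass (spanSection hγ i) := by
    rw [sum_smul_secClass, secClass_eq_iff]
    filter_upwards [ae_all_iff.2 fun i => coeFn_constL0 (μ := μ) (e n i)] with x hx
    rw [hσ, coe_sum_apply]
    refine Finset.sum_congr rfl fun i _ => ?_
    change _ = (constL0 μ (e n i)) x • γ i x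
    rw [hx]
  change secClass (σ (e n)) ∈ _
  rw [h]
  exact Submodule.sum_mem _ fun i _ => Submodule.smul_mem _ _ (Submodule.subset_span ⟨i, rfl⟩)

end spanBundle

section essSurj

variable {X : Type u} [MeasurableSpace X] {μ : Measure X}

theorem constL0_add (a b : ℝ) : constL0 μ (a + b) = constL0 μ a + constL0 μ b := rfl

theorem constL0_mul (a b : ℝ) : constL0 μ (a * b) = constL0 μ a * constL0 μ b := rfl

theorem constL0_zero : constL0 μ 0 = 0 := rfl

theorem constL0_one : constL0 μ 1 = 1 := rfl

section combination

variable {M : Type w} [AddCommGroup M] [Module (L0 μ) M]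

/-- The linear combination of a sequence in a module with constant rational coefficients. -/
noncomputable def ratComb (μ : Measure X) [Module (L0 μ) M] (w : ℕ → M) (q : ℕ →₀ ℚ) : M :=
  q.sum fun i c => constL0 μ c • w i

theorem ratComb_add (w : ℕ → M) (q r : ℕ →₀ ℚ) :
    ratComb μ w (q + r) = ratComb μ w q + ratComb μ w r :=
  Finsupp.sum_add_index' (by simp [constL0_zero]) fun i a b => by
    rw [Rat.cast_add, constL0_add, add_smul]

theorem ratComb_smul (w : ℕ → M) (c : ℚ) (q : ℕ →₀ ℚ) :
    ratComb μ w (c • q) = constL0 μ c • ratComb μ w q := by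
  rw [ratComb, Finsupp.sum_smul_index (by simp [constL0_zero]), ratComb, Finsupp.smul_sum]
  simp only [Rat.cast_mul, constL0_mul, mul_smul]

theorem ratComb_single (w : ℕ → M) (i : ℕ) : ratComb μ w (Finsupp.single i 1) = w i := by
  rw [ratComb, Finsupp.sum_single_index (by simp [constL0_zero]), Rat.cast_one, constL0_one,
    one_smul]

variable [PointwiseNorm μ M]

/-- Almost every fiber of the pointwise norm is a seminorm on rational combinations. -/
theorem ae_isRatSeminorm {w : ℕ → M} (hw : ∀ i, ∀ᵐ x ∂μ, pnorm μ (w i) x ≤ 1) :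
    ∀ᵐ x ∂μ, IsRatSeminorm fun q => pnorm μ (ratComb μ w q) x := by
  have h1 : ∀ᵐ x ∂μ, ∀ q r, pnorm μ (ratComb μ w (q + r)) x ≤
      pnorm μ (ratComb μ w q) x + pnorm μ (ratComb μ w r) x := by
    rw [ae_all_iff]
    intro q
    rw [ae_all_iff]
    intro r
    rw [ratComb_add]
    exact coeFn_pnorm_add_le _ _
  have h2 : ∀ᵐ x ∂μ, ∀ (c : ℚ) q, pnorm μ (ratComb μ w (c • q)) x =
      |(c : ℝ)| * pnorm μ (ratComb μ w q) x := by
    rw [ae_all_iff]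
    intro c
    rw [ae_all_iff]
    intro q
    rw [ratComb_smul]
    filter_upwards [coeFn_pnorm_smul (constL0 μ c) (ratComb μ w q), coeFn_constL0 (μ := μ) c]
      with x h3 h4
    rw [h3, h4]
  filter_upwards [h1, h2, ae_all_iff.2 hw] with x h3 h4 h5
  exact ⟨h3, h4, fun i => by rw [ratComb_single]; exact h5 i⟩

/-- If the norms of all rational combinations of `w` are computed by a family `z x` of sequences in
a normed space, then so are the norms of all combinations with coefficients in `L⁰(μ)`: for almost
every `x`, both sides are continuous in the coefficients at `x` and agree for rational ones. -/
theorem coeFn_pnorm_sum_smul {𝔹 : Type v} [NormedAddCommGroup 𝔹] [NormedSpace ℝ 𝔹] {w : ℕ → M}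
    (hw : ∀ i, ∀ᵐ x ∂μ, pnorm μ (w i) x ≤ 1) {z : X → ℕ → 𝔹}
    (hz : ∀ᵐ x ∂μ, ∀ q : ℕ →₀ ℚ,
      ‖∑ i ∈ q.support, (q i : ℝ) • z x i‖ = pnorm μ (ratComb μ w q) x)
    (S : Finset ℕ) (f : ℕ → L0 μ) :
    pnorm μ (∑ i ∈ S, f i • w i) =ᵐ[μ] fun x => ‖∑ i ∈ S, f i x • z x i‖ := by
  classical
  have hfilter : ∀ (q : ℕ →₀ ℚ), (q.filter (· ∈ S)).support ⊆ S := fun q => by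
    simp [Finsupp.support_filter, Finset.subset_iff]
  have hle : ∀ᵐ x ∂μ, ∀ q : ℕ →₀ ℚ,
      |pnorm μ (∑ i ∈ S, f i • w i) x - pnorm μ (ratComb μ w (q.filter (· ∈ S))) x| ≤
        ∑ i ∈ S, |f i x - q i| := by
    rw [ae_all_iff]
    intro q
    have hcomb : ratComb μ w (q.filter (· ∈ S)) = ∑ i ∈ S, constL0 μ (q i) • w i := by
      rw [ratComb, Finsupp.sum_of_support_subset _ (hfilter q) _ (by simp [constL0_zero])]
      refine Finset.sum_congr rfl fun i hi => ?_
      rw [Finsupp.filter_apply_pos _ _ hi]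
    have h1 := abs_pnorm_sub_pnorm_le (μ := μ) (∑ i ∈ S, f i • w i) (ratComb μ w (q.filter (· ∈ S)))
    have h2 := coeFn_pnorm_sum_le (μ := μ) S fun i => (f i - constL0 μ (q i)) • w i
    simp only [sub_smul, Finset.sum_sub_distrib] at h2
    rw [← hcomb] at h2
    have h3 := ae_all_iff.2 fun i => coeFn_pnorm_smul (f i - constL0 μ (q i)) (w i)
    simp only [sub_smul] at h3
    filter_upwards [h1, h2, h3, ae_all_iff.2 hw,
      ae_all_iff.2 fun i => AEEqFun.coeFn_sub (f i) (constL0 μ (q i)),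
      ae_all_iff.2 fun i => coeFn_constL0 (μ := μ) (q i)] with x h1 h2 h3 h4 h5 h6
    refine h1.trans (h2.trans (Finset.sum_le_sum fun i _ => ?_))
    rw [h3, h5, Pi.sub_apply, h6]
    exact mul_le_of_le_one_right (abs_nonneg _) (h4 i)
  filter_upwards [hle, hz] with x hx hzx
  have hreal := forall_real_of_forall_rat
    (C := {b | |pnorm μ (∑ i ∈ S, f i • w i) x - ‖∑ i ∈ S, b i • z x i‖| ≤ ∑ i ∈ S, |f i x - b i|})
    (isClosed_le (by fun_prop) (by fun_prop)) (fun q => by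
      have h := Finsupp.sum_of_support_subset (q.filter (· ∈ S)) (hfilter q)
        (fun i c => (c : ℝ) • z x i) (by simp)
      have h' : ∑ i ∈ S, (q i : ℝ) • z x i =
          ∑ i ∈ (q.filter (· ∈ S)).support, ((q.filter (· ∈ S)) i : ℝ) • z x i := by
        refine Eq.trans (Finset.sum_congr rfl fun i hi => ?_) h.symm
        rw [Finsupp.filter_apply_pos _ _ hi]
      change |_ - ‖∑ i ∈ S, (q i : ℝ) • z x i‖| ≤ _
      rw [h', hzx]
      exact hx q) (fun i => f i x)
  change |_ - ‖∑ i ∈ S, f i x • z x i‖| ≤ ∑ i ∈ S, |f i x - f i x| at hreal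
  simp only [sub_self, abs_zero, Finset.sum_const_zero] at hreal
  exact sub_eq_zero.1 (abs_nonpos_iff.1 hreal)

/-- Every element of a module is a multiple of one of pointwise norm at most `1`. -/
theorem exists_smul_pnorm_le_one (v : M) :
    ∃ (w : M) (d : L0 μ), v = d • w ∧ ∀ᵐ x ∂μ, pnorm μ w x ≤ 1 := by
  have hm : Measurable fun x => (1 + |pnorm μ v x|) :=
    measurable_const.add (pnorm μ v).measurable.abs
  let d : L0 μ := AEEqFun.mk _ hm.aestronglyMeasurable
  let c : L0 μ := AEEqFun.mk _ hm.inv.aestronglyMeasurable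
  have hd : d =ᵐ[μ] fun x => 1 + |pnorm μ v x| := AEEqFun.coeFn_mk _ _
  have hc : c =ᵐ[μ] fun x => (1 + |pnorm μ v x|)⁻¹ := AEEqFun.coeFn_mk _ _
  refine ⟨c • v, d, ?_, ?_⟩
  · have hdc : d * c = 1 := by
      refine AEEqFun.ext ?_
      filter_upwards [hd, hc, AEEqFun.coeFn_mul d c,
        AEEqFun.coeFn_one (α := X) (μ := μ) (β := ℝ)] with x h1 h2 h3 h4
      rw [h3, h4, Pi.mul_apply, h1, h2, Pi.one_apply]
      exact mul_inv_cancel₀ (by positivity)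
    rw [smul_smul, hdc, one_smul]
  · filter_upwards [hc, coeFn_pnorm_smul c v] with x h1 h2
    rw [h2, h1, abs_of_pos (by positivity), inv_mul_le_iff₀ (by positivity), mul_one]
    linarith [le_abs_self (pnorm μ v x)]

end combination

variable [SigmaFinite μ]

theorem exists_normalized_generators {M : NormedL0Module.{u, w} μ}
    (hM : IsCountablyGenerated μ M) : ∃ w : ℕ → M, (∀ i, ∀ᵐ x ∂μ, pnorm μ (w i) x ≤ 1) ∧
      Dense (Submodule.span (L0 μ) (Set.range w) : Set M) := by
  obtain ⟨C, hC, hd⟩ := hM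
  -- Adding `0` makes the generating set nonempty, so that a sequence enumerates it.
  obtain ⟨v, hv⟩ := (hC.insert 0).exists_eq_range (Set.insert_nonempty _ _)
  choose w d hvw hw using fun n => exists_smul_pnorm_le_one (μ := μ) (v n)
  refine ⟨w, hw, hd.mono (Submodule.span_le.2 fun y hy => ?_)⟩
  obtain ⟨n, rfl⟩ : y ∈ Set.range v := hv ▸ Set.mem_insert_of_mem _ hy
  rw [hvw n]
  exact Submodule.smul_mem _ _ (Submodule.subset_span ⟨n, rfl⟩)

variable {𝔹 : Type v} [NormedAddCommGroup 𝔹] [NormedSpace ℝ 𝔹] [CompleteSpace 𝔹]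
  [SeparableSpace 𝔹] [MeasurableSpace 𝔹] [BorelSpace 𝔹]

/-- Every countably generated normed module is the module of sections of a bundle: the pointwise
norms of the rational combinations of normalized generators form a measurable family of seminorms,
and the fibers are realized in `𝔹` through the functions on the Cantor set. -/
theorem exists_iso_gamModule (h𝔹 : IsUniversal.{v, w} 𝔹) {M : NormedL0Module.{u, max u v} μ}
    (hM : IsCountablyGenerated μ M) :
    ∃ E : SepBanachBundle μ 𝔹, Nonempty (GamModule E ≅ M) := by
  obtain ⟨J⟩ := h𝔹.exists_embedding
  obtain ⟨g, hgm, hg⟩ := exists_cantor_model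
  obtain ⟨w, hw, hd⟩ := exists_normalized_generators hM
  let _ : MeasurableSpace C(ℕ → Bool, ℝ) := borel _
  have : BorelSpace C(ℕ → Bool, ℝ) := ⟨rfl⟩
  let p : X → (ℕ →₀ ℚ) → ℝ := fun x q => pnorm μ (ratComb μ w q) x
  have hp : Measurable p := measurable_pi_lambda _ fun q => (pnorm μ (ratComb μ w q)).measurable
  let γ : ℕ → X → 𝔹 := fun n x => J (g n (p x))
  have hγ : ∀ n, Measurable (γ n) := fun n =>
    J.continuous.measurable.comp ((measurable_of_forall_eval (hgm n)).comp hp)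
  have hz : ∀ᵐ x ∂μ, ∀ q : ℕ →₀ ℚ,
      ‖∑ i ∈ q.support, (q i : ℝ) • γ i x‖ = pnorm μ (ratComb μ w q) x := by
    filter_upwards [ae_isRatSeminorm hw] with x hx q
    have h : ∑ i ∈ q.support, (q i : ℝ) • γ i x =
        J (∑ i ∈ q.support, (q i : ℝ) • g i (p x)) := by
      simp only [map_sum, map_smul, γ]
    rw [h, J.norm_map]
    exact hg _ hx q
  let E := spanBundle μ γ hγ
  let σ : ℕ → GamModule E := fun n => secClass (spanSection hγ n)
  refine ⟨E, NormedL0Module.nonempty_iso_of_submodule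
    (Submodule.span (L0 μ) (Set.range fun n => (σ n, w n))) ?_ ?_ ?_⟩
  · intro x hx
    obtain ⟨a, rfl⟩ := Finsupp.mem_span_range_iff_exists_finsupp.1 hx
    rw [Finsupp.sum, Prod.fst_sum, Prod.snd_sum]
    refine AEEqFun.ext ?_
    exact (coeFn_pnorm_sum_smul_secClass a.support a (spanSection hγ)).trans
      (coeFn_pnorm_sum_smul hw (z := fun x i => γ i x) hz a.support a).symm
  · refine (dense_span_spanSection (μ := μ) hγ).mono ?_
    rw [← LinearMap.coe_fst (R := L0 μ), ← Submodule.map_coe, Submodule.map_span, ← Set.range_comp]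
    exact subset_rfl
  · refine hd.mono ?_
    rw [← LinearMap.coe_snd (R := L0 μ), ← Submodule.map_coe, Submodule.map_span, ← Set.range_comp]
    exact subset_rfl

/-- The section functor is an equivalence onto every full subcategory of countably generated modules
that contains its values. -/
theorem isEquivalence_lift_sectionFunctor (h𝔹 : IsUniversal.{v, w} 𝔹)
    {P : ObjectProperty (NormedL0Module.{u, max u v} μ)}
    (hΓ : ∀ E, P ((sectionFunctor μ 𝔹).obj E)) (hP : ∀ M, P M → IsCountablyGenerated μ M) :
    (P.lift (sectionFunctor μ 𝔹) hΓ).IsEquivalence where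
  essSurj := ⟨fun M => by
    obtain ⟨E, ⟨e⟩⟩ := exists_iso_gamModule h𝔹 (hP _ M.property)
    exact ⟨E, ⟨ObjectProperty.isoMk _ e⟩⟩⟩

end essSurj

theorem isCountablyGenerated_of_isSeparableModule {X : Type u} [MeasurableSpace X] {μ : Measure X}
    [SigmaFinite μ] {M : NormedL0Module.{u, w} μ} (hM : IsSeparableModule μ M) :
    IsCountablyGenerated μ M := by
  have : SeparableSpace M := hM
  obtain ⟨C, hC, hd⟩ := exists_countable_dense M
  exact ⟨C, hC, hd.mono Submodule.subset_span⟩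

end SerreSwan

theorem mainTheorem2 {X : Type u} [MeasurableSpace X] (μ : MeasureTheory.Measure X)
    [μ.IsComplete] [MeasureTheory.SigmaFinite μ]
    (𝔹 : Type v) [NormedAddCommGroup 𝔹] [NormedSpace ℝ 𝔹] [CompleteSpace 𝔹]
    [TopologicalSpace.SeparableSpace 𝔹] [MeasurableSpace 𝔹] [BorelSpace 𝔹]
    (h𝔹 : SerreSwan.IsUniversal.{v, w} 𝔹) :
    (∃ hΓ : ∀ E, SerreSwan.IsCountablyGenerated μ ((SerreSwan.sectionFunctor μ 𝔹).obj E),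
      ((SerreSwan.IsCountablyGenerated μ).lift (SerreSwan.sectionFunctor μ 𝔹) hΓ :
        SerreSwan.SepBanachBundle μ 𝔹 ⥤ SerreSwan.NModCG.{u, max u v} μ).IsEquivalence) ∧
    (SerreSwan.IsSeparableMeasureSpace μ →
      ∃ hΓ : ∀ E, SerreSwan.IsSeparableModule μ ((SerreSwan.sectionFunctor μ 𝔹).obj E),
        ((SerreSwan.IsSeparableModule μ).lift (SerreSwan.sectionFunctor μ 𝔹) hΓ :
          SerreSwan.SepBanachBundle μ 𝔹 ⥤ SerreSwan.NModS.{u, max u v} μ).IsEquivalence) := by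
  exact ⟨⟨SerreSwan.isCountablyGenerated_gamModule,
      SerreSwan.isEquivalence_lift_sectionFunctor h𝔹 _ fun _ hM => hM⟩,
    fun h => ⟨SerreSwan.isSeparableModule_gamModule h,
      SerreSwan.isEquivalence_lift_sectionFunctor h𝔹 _ fun _ hM =>
        SerreSwan.isCountablyGenerated_of_isSeparableModule hM⟩⟩
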